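/- Let $X_\omega=\{x_1,x_2,\dots\}$ be a countably infinite set, $F_\omega$ the free group with basis $X_\omega$, and $X_\omega^{\pm}=X_\omega\cup X_\omega^{-1}$. Automorphisms act on the right, so $\alpha\beta$ means first $\alpha$, then $\beta$. For $x,y\in X_\omega^{\pm}$ with $x\neq y^{\pm1}$ let $E_{xy}\in\mathrm{Aut}(F_\omega)$ be the elementary Nielsen automorphism of the first kind which sends $x$ to $xy$ and fixes all elements of $X_\omega^{\pm}\setminus\{x,x^{-1}\}$; let $\mathcal E$ be the set of all $E_{xy}$, with the free involution $E_{xy}^{-1}=E_{xy^{-1}}$. *Words.* For a set $\Lambda$ with a free involution $\lambda\mapsto\lambda^{-1}$, a word over $\Lambda$ is a map $f:S\to\Lambda$ with finite fibres defined on a totally ordered set $S$, taken up to order isomorphism of $S$. Words are multiplied by concatenation, and $\bar f$ denotes the word obtained from $f$ by reversing the order and inverting every letter. A word $g$ is obtained from $f$ by cancellation if $g=f|_{S\setminus T}$ for some $T\subseteq S$ carrying an involution $*$ such that $f(t^*)=f(t)^{-1}$, $[t,t^*]\subseteq T$ and $[t,t^*]^*=[t,t^*]$ for all $t\in T$. A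 nonempty set $\mathcal S$ of words is admissible if it is closed under concatenation, $f\mapsto\bar f$ and cancellation; then $\mathrm{BF}(\Lambda,\mathcal S)$ is the group of classes $[f]$ of words $f\in\mathcal S$ modulo the equivalence relation on $\mathcal S$ generated by cancellation, with $[f][g]=[fg]$. A group $G$ is generated by a subset $A$ in the generalized sense if there are a set $\Lambda$ with a free involution, an admissible set $\mathcal S$ of words over $\Lambda$ containing all one-letter words, and an epimorphism $p:\mathrm{BF}(\Lambda,\mathcal S)\to G$ with $p(\Lambda)=A\cup A^{-1}$. *The set $\mathcal S$ and the homomorphism $\Psi$.* For a word $f:S\to\mathcal E$ write $f(s)=E_{f_1(s)f_2(s)}$. Let $\mathcal S_0$ be the set of words $f$ over $\mathcal E$ such that $f_1^{-1}(x)$ is finite for every $x\in X_\omega^{\pm}$, and $\mathcal S_1$ the set of those for which there is no injective order-preserving map $\varphi:\mathbb N\to S$ with $f_1(\varphi(n+1))=f_2(\varphi(n))^{\pm1}$ for all $n$. Let $\mathcal S=\{f : f\in\mathcal S_0 \text{ and } f,\bar f\in\mathcal S_1\}$; it is admissible. For $f\in\mathcal S$ and $x\in X_\omega^{\pm}$ let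 $C(f,x)\subseteq S$ be the smallest set that contains every $s\in S$ with $f_1(s)=x^{\pm1}$ and every $s\in S$ such that $f_1(s)=f_2(t)^{\pm1}$ for some $t<s$ in $C(f,x)$. This set is finite, say $C(f,x)=\{s_1<\dots<s_n\}$, and $x\alpha_f:=x\,f(s_1)f(s_2)\cdots f(s_n)$ defines an automorphism $\alpha_f$ of $F_\omega$. The rule $\Psi[f]=\alpha_f$ gives a well-defined homomorphism $\Psi:\mathrm{BF}(\mathcal E,\mathcal S)\to\mathrm{Aut}(F_\omega)$. **Theorem.** The homomorphism $\Psi:\mathrm{BF}(\mathcal E,\mathcal S)\to\mathrm{Aut}(F_\omega)$ is surjective. Consequently $\mathrm{Aut}(F_\omega)$ is generated in the generalized sense by the set $\mathcal E$ of elementary Nielsen automorphisms of the first kind. -/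

import Mathlib

universe u v

namespace BigFree

/-! ## Words over a set with a free involution -/

/-- A set with a free involution `a ↦ a⁻¹`. -/
class FreeInvolution (Λ : Type u) extends InvolutiveInv Λ where
  inv_ne_self : ∀ a : Λ, a⁻¹ ≠ a

/-- A (possibly infinite) word over `Λ`: a map from a totally ordered set to `Λ` all of whose
fibres are finite. -/
structure Word (Λ : Type u) where
  /-- the totally ordered set of positions -/
  pos : Type u
  [ord : LinearOrder pos]
  /-- the letter at a position -/
  letter : pos → Λ
  finite_fiber : ∀ a : Λ, (letter ⁻¹' {a}).Finite

attribute [instance] Word.ord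

namespace Word

variable {Λ : Type u}

/-- The empty word. -/
def empty (Λ : Type u) : Word Λ where
  pos := PEmpty
  letter := PEmpty.elim
  finite_fiber _ := Set.toFinite _

/-- The word with the single letter `a`. -/
def single (a : Λ) : Word Λ where
  pos := PUnit
  letter _ := a
  finite_fiber _ := Set.toFinite _

/-- Concatenation `f g`: all positions of `f` come before those of `g`. -/
noncomputable def concat (f g : Word Λ) : Word Λ where
  pos := f.pos ⊕ₗ g.pos
  letter s := Sum.elim f.letter g.letter (ofLex s)
  finite_fiber a := by
    refine (((f.finite_fiber a).image (fun s => toLex (Sum.inl s))).union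
      ((g.finite_fiber a).image (fun s => toLex (Sum.inr s)))).subset ?_
    rintro s hs
    rcases h : ofLex s with t | t
    · exact Or.inl ⟨t, by simpa [h] using hs, congrArg toLex h.symm⟩
    · exact Or.inr ⟨t, by simpa [h] using hs, congrArg toLex h.symm⟩

variable [FreeInvolution Λ]

/-- The formal inverse of a word: reverse the order and invert every letter. -/
def bar (f : Word Λ) : Word Λ where
  pos := f.posᵒᵈ
  letter s := (f.letter (OrderDual.ofDual s))⁻¹
  finite_fiber a := by
    refine ((f.finite_fiber a⁻¹).image OrderDual.toDual).subset ?_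
    intro s hs
    refine ⟨OrderDual.ofDual s, ?_, rfl⟩
    have : (f.letter (OrderDual.ofDual s))⁻¹ = a := hs
    simp [← this]

/-- `Cancels f g`: the word `g` is obtained from `f` by cancellation, i.e. up to an order
isomorphism `g` is the restriction of `f` to the complement of a set `T` of positions carrying an
involution `star` with `f (t*) = (f t)⁻¹`, `[t, t*] ⊆ T` and `[t, t*]* = [t, t*]` for `t ∈ T`. The
order embedding `e` identifies `g` with that restriction; `T = ∅` gives the identification of
isomorphic words. -/
def Cancels (f g : Word Λ) : Prop :=
  ∃ (T : Set f.pos) (star : f.pos → f.pos) (e : g.pos ↪o f.pos),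
    Set.range e = Tᶜ ∧ (∀ s, g.letter s = f.letter (e s)) ∧
    ∀ t ∈ T, star t ∈ T ∧ star (star t) = t ∧ f.letter (star t) = (f.letter t)⁻¹ ∧
      Set.Icc t (star t) ⊆ T ∧ star '' Set.Icc t (star t) = Set.Icc t (star t)

theorem Cancels.of_iso {f g : Word Λ} (e : g.pos ≃o f.pos)
    (h : ∀ s, g.letter s = f.letter (e s)) : Cancels f g :=
  ⟨∅, id, e.toOrderEmbedding, by simp [Set.range_eq_univ.2 e.surjective], h, by simp⟩

theorem Cancels.bar {f g : Word Λ} (h : Cancels f g) : Cancels f.bar g.bar := by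
  obtain ⟨T, star, e, he, hl, hT⟩ := h
  refine ⟨OrderDual.ofDual ⁻¹' T, fun s => OrderDual.toDual (star (OrderDual.ofDual s)), e.dual,
    ?_, ?_, ?_⟩
  · ext s
    have := Set.ext_iff.1 he (OrderDual.ofDual s)
    exact this
  · intro s
    exact congrArg (·⁻¹) (hl _)
  · intro t ht
    obtain ⟨h1, h2, h3, -, -⟩ := hT _ ht
    obtain ⟨-, -, -, h4, h5⟩ := hT _ h1
    rw [h2] at h4 h5
    refine ⟨h1, h2, congrArg (·⁻¹) h3, ?_, ?_⟩
    · rintro s ⟨hs1, hs2⟩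
      exact h4 ⟨hs2, hs1⟩
    · ext s
      have := Set.ext_iff.1 h5 (OrderDual.ofDual s)
      constructor
      · rintro ⟨r, ⟨hr1, hr2⟩, rfl⟩
        obtain ⟨a, b⟩ := this.1 ⟨_, ⟨hr2, hr1⟩, rfl⟩
        exact ⟨b, a⟩
      · rintro ⟨hr1, hr2⟩
        obtain ⟨r, ⟨a, b⟩, hr⟩ := this.2 ⟨hr2, hr1⟩
        exact ⟨OrderDual.toDual r, ⟨b, a⟩, hr⟩

theorem Cancels.concat_left {f g : Word Λ} (h : Cancels f g) (k : Word Λ) :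
    Cancels (concat f k) (concat g k) := by
  obtain ⟨T, star, e, he, hl, hT⟩ := h
  refine ⟨(fun s => toLex (Sum.inl s)) '' T,
    fun s => toLex (Sum.map star id (ofLex s)),
    OrderEmbedding.ofMapLEIff (fun s => toLex (Sum.map e id (ofLex s))) ?_, ?_, ?_, ?_⟩
  · intro a b
    rcases a with a | a <;> rcases b with b | b
    · exact Sum.Lex.inl_le_inl_iff.trans (e.le_iff_le.trans Sum.Lex.inl_le_inl_iff.symm)
    · exact iff_of_true (Sum.Lex.inl_le_inr _ _) (Sum.Lex.inl_le_inr _ _)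
    · exact iff_of_false Sum.Lex.not_inr_le_inl Sum.Lex.not_inr_le_inl
    · exact Sum.Lex.inr_le_inr_iff.trans Sum.Lex.inr_le_inr_iff.symm
  · ext s
    rcases s with s | s
    · have := Set.ext_iff.1 he s
      constructor
      · rintro ⟨r | r, hr⟩ ⟨t, ht, h'⟩
        · have h1 : e r = s := Sum.inl_injective hr
          have h2 : t = s := Sum.inl_injective h'
          exact this.1 ⟨r, h1⟩ (h2 ▸ ht)
        · exact Sum.inr_ne_inl hr
      · intro hs
        obtain ⟨r, hr⟩ := this.2 (fun hs' => hs ⟨s, hs', rfl⟩)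
        exact ⟨toLex (Sum.inl r), congrArg (fun z => toLex (Sum.inl z)) hr⟩
    · refine iff_of_true ⟨toLex (Sum.inr s), rfl⟩ ?_
      rintro ⟨t, _, h'⟩
      exact Sum.inl_ne_inr h'
  · rintro (s | s)
    · exact hl s
    · rfl
  · rintro _ ⟨t, ht, rfl⟩
    obtain ⟨h1, h2, h3, h4, h5⟩ := hT t ht
    have key : Set.Icc (toLex (Sum.inl t) : f.pos ⊕ₗ k.pos) (toLex (Sum.inl (star t))) =
        (fun s => toLex (Sum.inl s)) '' Set.Icc t (star t) := by
      ext s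
      constructor
      · rcases s with s | s
        · rintro ⟨a, b⟩
          exact ⟨s, ⟨Sum.Lex.inl_le_inl_iff.1 a, Sum.Lex.inl_le_inl_iff.1 b⟩, rfl⟩
        · rintro ⟨a, b⟩
          exact absurd b Sum.Lex.not_inr_le_inl
      · rintro ⟨s, ⟨a, b⟩, rfl⟩
        exact ⟨Sum.Lex.inl_le_inl_iff.2 a, Sum.Lex.inl_le_inl_iff.2 b⟩
    refine ⟨⟨_, h1, rfl⟩, congrArg (fun z => toLex (Sum.inl z)) h2, h3, ?_, ?_⟩
    · exact key.trans_subset (Set.image_mono h4)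
    · refine (congrArg _ key).trans (Eq.trans ?_ key.symm)
      ext s
      constructor
      · rintro ⟨_, ⟨r, hr, rfl⟩, rfl⟩
        exact ⟨star r, h5.subset ⟨r, hr, rfl⟩, rfl⟩
      · rintro ⟨r, hr, rfl⟩
        obtain ⟨q, hq, rfl⟩ := h5.superset hr
        exact ⟨_, ⟨q, hq, rfl⟩, rfl⟩

/-- The order-reversing exchange of the two halves of `f⁻¹ f`. -/
def mirror (f : Word Λ) (s : (concat f.bar f).pos) : (concat f.bar f).pos :=
  toLex (Sum.elim (fun a => Sum.inr (OrderDual.ofDual a)) (fun a => Sum.inl (OrderDual.toDual a))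
    (ofLex s))

/-- `f⁻¹ f` cancels to the empty word. -/
theorem cancels_bar_concat (f : Word Λ) : Cancels (concat f.bar f) (empty Λ) := by
  have anti : ∀ a b : (concat f.bar f).pos, a ≤ b → f.mirror b ≤ f.mirror a := by
    rintro (a | a) (b | b) h
    · have h' := Sum.Lex.inl_le_inl_iff.1 h
      exact Sum.Lex.inr_le_inr_iff.2 h'
    · exact Sum.Lex.inl_le_inr _ _
    · exact absurd h Sum.Lex.not_inr_le_inl
    · have h' := Sum.Lex.inr_le_inr_iff.1 h
      exact Sum.Lex.inl_le_inl_iff.2 h'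
  have invol : ∀ a : (concat f.bar f).pos, f.mirror (f.mirror a) = a := by
    rintro (a | a) <;> rfl
  refine ⟨Set.univ, f.mirror, ⟨⟨PEmpty.elim, fun a => a.elim⟩, fun {a} => a.elim⟩,
    ?_, fun s => s.elim, ?_⟩
  · ext s
    exact iff_of_false (fun ⟨a, _⟩ => a.elim) (fun h => h trivial)
  · intro t _
    refine ⟨trivial, invol t, ?_, Set.subset_univ _, ?_⟩
    · rcases t with t | t
      · exact (inv_inv _).symm
      · rfl
    · ext s
      constructor
      · rintro ⟨r, ⟨a, b⟩, rfl⟩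
        exact ⟨by simpa only [invol] using anti _ _ b, anti _ _ a⟩
      · rintro ⟨a, b⟩
        exact ⟨_, ⟨by simpa only [invol] using anti _ _ b, anti _ _ a⟩, invol s⟩

end Word

/-! ## Admissible sets of words and generalized free groups -/

/-- A (nonempty) admissible set of words: closed under concatenation, formal inversion and
cancellation. Closure under cancellation includes closure under isomorphism of words. -/
structure AdmissibleSet (Λ : Type u) [FreeInvolution Λ] where
  carrier : Set (Word Λ)
  nonempty : carrier.Nonempty
  concat_mem : ∀ {f g}, f ∈ carrier → g ∈ carrier → Word.concat f g ∈ carrier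
  bar_mem : ∀ {f}, f ∈ carrier → f.bar ∈ carrier
  cancel_mem : ∀ {f g}, f ∈ carrier → Word.Cancels f g → g ∈ carrier

section BF

variable {Λ : Type u} [FreeInvolution Λ]

theorem AdmissibleSet.empty_mem (S : AdmissibleSet Λ) : Word.empty Λ ∈ S.carrier := by
  obtain ⟨f, hf⟩ := S.nonempty
  exact S.cancel_mem (S.concat_mem (S.bar_mem hf) hf) (Word.cancels_bar_concat f)

/-- `BF(Λ, 𝒮)`: the quotient of an admissible set `𝒮` by the equivalence relation generated by
cancellation (`Quot` takes the generated equivalence relation). -/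
def BF (S : AdmissibleSet Λ) : Type (u + 1) :=
  Quot fun f g : {f // f ∈ S.carrier} => Word.Cancels f.1 g.1

/-- The class `[f]` of a word `f ∈ 𝒮`. -/
def BF.mk (S : AdmissibleSet Λ) (f : Word Λ) (hf : f ∈ S.carrier) : BF S :=
  Quot.mk _ ⟨f, hf⟩

theorem BF.sound {S : AdmissibleSet Λ} {f g : Word Λ} (hf : f ∈ S.carrier) (hg : g ∈ S.carrier)
    (h : Word.Cancels f g) : BF.mk S f hf = BF.mk S g hg :=
  Quot.sound h

theorem BF.mk_bar_congr {S : AdmissibleSet Λ} {f g : Word Λ} (hf : f ∈ S.carrier)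
    (hg : g ∈ S.carrier) (h : Word.Cancels f g) :
    BF.mk S f.bar (S.bar_mem hf) = BF.mk S g.bar (S.bar_mem hg) :=
  BF.sound _ _ h.bar

/-- `(g⁻¹ f⁻¹)⁻¹` is `f g`. -/
theorem Word.cancels_bar_bar_concat (f g : Word Λ) :
    Word.Cancels (Word.concat g.bar f.bar).bar (Word.concat f g) := by
  refine Word.Cancels.of_iso ⟨⟨fun s => OrderDual.toDual (toLex (Sum.elim
      (fun a => Sum.inr (OrderDual.toDual a)) (fun a => Sum.inl (OrderDual.toDual a)) (ofLex s))),
    fun s => toLex (Sum.elim (fun a => Sum.inr (OrderDual.ofDual a))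
      (fun a => Sum.inl (OrderDual.ofDual a)) (ofLex (OrderDual.ofDual s))), ?_, ?_⟩, ?_⟩ ?_
  · rintro (s | s) <;> rfl
  · rintro (s | s) <;> rfl
  · rintro (a | a) (b | b)
    · refine Sum.Lex.inr_le_inr_iff.trans ?_
      exact ⟨fun h => Sum.Lex.inl_le_inl_iff.2 h, fun h => by
        have h' := Sum.Lex.inl_le_inl_iff.1 h
        exact h'⟩
    · exact iff_of_true (Sum.Lex.inl_le_inr _ _) (Sum.Lex.inl_le_inr _ _)
    · exact iff_of_false Sum.Lex.not_inr_le_inl Sum.Lex.not_inr_le_inl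
    · refine Sum.Lex.inl_le_inl_iff.trans ?_
      exact ⟨fun h => Sum.Lex.inr_le_inr_iff.2 h, fun h => by
        have h' := Sum.Lex.inr_le_inr_iff.1 h
        exact h'⟩
  · rintro (s | s)
    · exact (inv_inv _).symm
    · exact (inv_inv _).symm

theorem BF.mk_concat_right {S : AdmissibleSet Λ} {f g h : Word Λ} (hf : f ∈ S.carrier)
    (hg : g ∈ S.carrier) (hh : h ∈ S.carrier) (H : Word.Cancels g h) :
    BF.mk S (f.concat g) (S.concat_mem hf hg) = BF.mk S (f.concat h) (S.concat_mem hf hh) := by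
  have hb := @S.bar_mem
  have hc := @S.concat_mem
  rw [← BF.sound (hb (hc (hb hg) (hb hf))) _ (Word.cancels_bar_bar_concat f g),
    ← BF.sound (hb (hc (hb hh) (hb hf))) _ (Word.cancels_bar_bar_concat f h)]
  exact BF.sound _ _ (H.bar.concat_left _).bar

theorem Word.cancels_concat_assoc (f g h : Word Λ) :
    Word.Cancels ((f.concat g).concat h) (f.concat (g.concat h)) := by
  refine Word.Cancels.of_iso (OrderIso.sumLexAssoc f.pos g.pos h.pos).symm ?_
  rintro (s | s | s) <;> rfl

theorem Word.cancels_empty_concat (f : Word Λ) : Word.Cancels ((Word.empty Λ).concat f) f :=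
  Word.Cancels.of_iso ⟨⟨fun s => toLex (Sum.inr s),
    fun s => Sum.elim PEmpty.elim id (ofLex s), fun _ => rfl,
    by rintro (s | s); exacts [s.elim, rfl]⟩, Sum.Lex.inr_le_inr_iff⟩ fun _ => rfl

noncomputable instance BF.instMul (S : AdmissibleSet Λ) : Mul (BF S) :=
  ⟨Quot.lift₂ (fun f g => BF.mk S (f.1.concat g.1) (S.concat_mem f.2 g.2))
    (fun f g h H => BF.mk_concat_right f.2 g.2 h.2 H)
    (fun _ _ h H => BF.sound _ _ (H.concat_left h.1))⟩

instance BF.instInv (S : AdmissibleSet Λ) : Inv (BF S) :=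
  ⟨Quot.map (fun f => ⟨f.1.bar, S.bar_mem f.2⟩) fun _ _ H => H.bar⟩

instance BF.instOne (S : AdmissibleSet Λ) : One (BF S) :=
  ⟨BF.mk S (Word.empty Λ) S.empty_mem⟩

/-- The group structure on `BF(Λ, 𝒮)`: `[f] [g] = [f g]` and `[f]⁻¹` is the class of the formal
inverse of `f`. -/
noncomputable instance BF.instGroup (S : AdmissibleSet Λ) : Group (BF S) :=
  Group.ofLeftAxioms
    (by
      rintro ⟨f⟩ ⟨g⟩ ⟨h⟩
      exact Quot.sound (Word.cancels_concat_assoc f.1 g.1 h.1))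
    (by
      rintro ⟨f⟩
      exact Quot.sound (Word.cancels_empty_concat f.1))
    (by
      rintro ⟨f⟩
      exact Quot.sound (Word.cancels_bar_concat f.1))

end BF

open scoped Pointwise in
/-- `G` is generated by `A` in the generalized sense: there are a set `Λ` with a free involution,
an admissible set `𝒮` of words over `Λ` that contains all one-letter words, and an epimorphism
`p : BF(Λ, 𝒮) → G` with `p(Λ) = A ∪ A⁻¹`. -/
def GeneratedInGeneralizedSense (G : Type u) [Group G] (A : Set G) : Prop :=
  ∃ (Λ : Type u) (_ : FreeInvolution Λ) (S : AdmissibleSet Λ)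
    (hS : ∀ a : Λ, Word.single a ∈ S.carrier) (p : BF S →* G),
    Function.Surjective p ∧ Set.range (fun a => p (BF.mk S (Word.single a) (hS a))) = A ∪ A⁻¹

/-! ## Elementary Nielsen automorphisms of the first kind -/

/-- The set `X^± = X ∪ X⁻¹`: the pair `(x, true)` stands for `x` and `(x, false)` for `x⁻¹`. -/
abbrev Letter (X : Type u) : Type u := X × Bool

/-- The involution `x ↦ x⁻¹` on `X^±`. -/
def Letter.bar {X : Type u} (a : Letter X) : Letter X := (a.1, !a.2)

/-- The inclusion of `X^±` into the free group `F(X)`. -/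
def Letter.toFree {X : Type u} (a : Letter X) : FreeGroup X := FreeGroup.mk [a]

/-- The set `ℰ` of letters `E_{xy}`, with `x, y ∈ X^±` and `x ≠ y^{±1}`; here `x = src` and
`y = tgt`. -/
@[ext] structure Elem (X : Type u) where
  src : Letter X
  tgt : Letter X
  ne : src ≠ tgt
  ne_bar : src ≠ tgt.bar

section Nielsen

variable {X : Type u}

theorem Letter.bar_bar (a : Letter X) : a.bar.bar = a := by
  simp [Letter.bar]

theorem Letter.toFree_bar (a : Letter X) : a.bar.toFree = a.toFree⁻¹ := rfl

theorem Letter.eq_or_eq_bar_iff (a b : Letter X) : (a = b ∨ a = b.bar) ↔ a.1 = b.1 := by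
  rcases a with ⟨x, i⟩
  rcases b with ⟨y, j⟩
  cases i <;> cases j <;> simp [Letter.bar]

theorem Elem.tgt_ne_src (E : Elem X) : E.tgt.1 ≠ E.src.1 := fun h =>
  ((Letter.eq_or_eq_bar_iff E.src E.tgt).2 h.symm).elim E.ne E.ne_bar

/-- The free involution `E_{xy}⁻¹ = E_{x y⁻¹}` on `ℰ`. -/
instance Elem.instFreeInvolution : FreeInvolution (Elem X) where
  inv E := ⟨E.src, E.tgt.bar, E.ne_bar, by rw [Letter.bar_bar]; exact E.ne⟩
  inv_inv E := by
    ext1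
    · rfl
    · exact Letter.bar_bar _
  inv_ne_self E h := by
    have h1 : E.tgt.bar = E.tgt := congrArg Elem.tgt h
    have h2 := congrArg Prod.snd h1
    simp [Letter.bar] at h2

@[simp] theorem Elem.src_inv (E : Elem X) : E⁻¹.src = E.src := rfl

@[simp] theorem Elem.tgt_inv (E : Elem X) : E⁻¹.tgt = E.tgt.bar := rfl

open Classical in
/-- The endomorphism of `F(X)` that sends `x` to `x y` and fixes the other basis elements; when
`x = z⁻¹` with `z ∈ X` this means `z ↦ y⁻¹ z`. -/
noncomputable def Elem.hom (E : Elem X) : FreeGroup X →* FreeGroup X :=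
  FreeGroup.lift fun z =>
    if z = E.src.1 then
      (if E.src.2 then FreeGroup.of z * E.tgt.toFree else E.tgt.toFree⁻¹ * FreeGroup.of z)
    else FreeGroup.of z

theorem Elem.hom_of_ne (E : Elem X) (z : X) (h : z ≠ E.src.1) :
    E.hom (FreeGroup.of z) = FreeGroup.of z := by
  simp [Elem.hom, h]

theorem Elem.hom_toFree_of_ne (E : Elem X) (a : Letter X) (h : a.1 ≠ E.src.1) :
    E.hom a.toFree = a.toFree := by
  rcases a with ⟨z, i⟩
  cases i
  · exact (map_inv E.hom (FreeGroup.of z)).trans (congrArg _ (E.hom_of_ne z h))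
  · exact E.hom_of_ne z h

theorem Elem.hom_src (E : Elem X) : E.hom E.src.toFree = E.src.toFree * E.tgt.toFree := by
  obtain ⟨⟨x, i⟩, y, h1, h2⟩ := E
  cases i
  · refine (map_inv _ (FreeGroup.of x)).trans ?_
    simp only [Elem.hom, FreeGroup.lift_apply_of]
    simp
    rfl
  · change Elem.hom _ (FreeGroup.of x) = FreeGroup.of x * _
    simp [Elem.hom]

theorem Elem.hom_comp_inv (E : Elem X) : E.hom.comp E⁻¹.hom = MonoidHom.id _ := by
  ext z
  by_cases hz : z = E.src.1
  · have key : E.hom (E⁻¹.hom E.src.toFree) = E.src.toFree := by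
      have := E⁻¹.hom_src
      rw [Elem.src_inv, Elem.tgt_inv] at this
      rw [this, map_mul, E.hom_src, Letter.toFree_bar, map_inv, E.hom_toFree_of_ne _ E.tgt_ne_src]
      simp
    obtain ⟨⟨x, i⟩, y, h1, h2⟩ := E
    subst hz
    cases i
    · have h3 := congrArg (·⁻¹) key
      simp only [← map_inv] at h3
      exact h3
    · exact key
  · have hz' : z ≠ E⁻¹.src.1 := hz
    simp [Elem.hom_of_ne _ _ hz, Elem.hom_of_ne _ _ hz']

/-- The automorphism `E_{xy}` of `F(X)`. -/
noncomputable def Elem.aut (E : Elem X) : MulAut (FreeGroup X) :=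
  E.hom.toMulEquiv E⁻¹.hom
    (by
      have := E⁻¹.hom_comp_inv
      rwa [inv_inv] at this)
    E.hom_comp_inv

end Nielsen

/-- The group `Aut(F(X))` of automorphisms acting on the right, so that the product `α β` means
`α` first and then `β`. -/
abbrev RAut (X : Type u) : Type u := (MulAut (FreeGroup X))ᵐᵒᵖ

/-- `act w α` is the image `w α` of `w ∈ F(X)` under `α ∈ Aut(F(X))`. -/
def act {X : Type u} (w : FreeGroup X) (α : RAut X) : FreeGroup X := α.unop w

/-- The elementary Nielsen automorphism of the first kind `E_{xy} ∈ Aut(F(X))`. -/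
noncomputable def Elem.toAut {X : Type u} (E : Elem X) : RAut X := MulOpposite.op E.aut

section Act

variable {X : Type u}

@[simp] theorem act_one (w : FreeGroup X) : act w 1 = w := rfl

theorem act_mul (w : FreeGroup X) (α β : RAut X) : act w (α * β) = act (act w α) β := rfl

theorem mul_act (v w : FreeGroup X) (α : RAut X) : act (v * w) α = act v α * act w α :=
  map_mul α.unop v w

theorem inv_act (w : FreeGroup X) (α : RAut X) : act w⁻¹ α = (act w α)⁻¹ :=
  map_inv α.unop w

theorem Elem.act_src (E : Elem X) :
    act E.src.toFree E.toAut = E.src.toFree * E.tgt.toFree := E.hom_src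

theorem Elem.act_of_ne (E : Elem X) (z : X) (h : z ≠ E.src.1) :
    act (FreeGroup.of z) E.toAut = FreeGroup.of z := E.hom_of_ne z h

theorem Elem.toAut_inv (E : Elem X) : E⁻¹.toAut = E.toAut⁻¹ := by
  refine congrArg MulOpposite.op ?_
  ext w
  rfl

theorem RAut.ext {α β : RAut X} (h : ∀ w, act w α = act w β) : α = β :=
  MulOpposite.unop_injective (MulEquiv.ext h)

/-- Different pairs `(x, y)` give different automorphisms `E_{xy}`, so that `ℰ` may be regarded as
a set of automorphisms. -/
theorem Elem.toAut_injective : Function.Injective (Elem.toAut (X := X)) := by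
  classical
  intro E D h
  have moved : ∀ E : Elem X, act (FreeGroup.of E.src.1) E.toAut ≠ FreeGroup.of E.src.1 := by
    intro E h
    have h1 : act E.src.toFree E.toAut = E.src.toFree := by
      obtain ⟨⟨x, i⟩, y, h1, h2⟩ := E
      cases i
      · exact (inv_act (FreeGroup.of x) _).trans (congrArg _ h)
      · exact h
    rw [E.act_src, mul_eq_left] at h1
    have := congrArg FreeGroup.toWord h1
    simp [Letter.toFree, FreeGroup.toWord_mk] at this
  have hs : E.src.1 = D.src.1 := by
    by_contra hne
    exact moved E (h ▸ D.act_of_ne _ hne)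
  have h2 : act E.src.toFree E.toAut = act E.src.toFree D.toAut := by rw [h]
  have hD := D.tgt_ne_src
  have hE := E.tgt_ne_src
  rcases (Letter.eq_or_eq_bar_iff _ _).2 hs with h3 | h3
  · rw [E.act_src, h3, D.act_src, mul_right_inj] at h2
    have := congrArg FreeGroup.toWord h2
    simp [Letter.toFree, FreeGroup.toWord_mk] at this
    exact Elem.ext h3 this
  · exfalso
    rw [E.act_src, h3, Letter.toFree_bar, inv_act, D.act_src, mul_inv_rev,
      ← Letter.toFree_bar, ← Letter.toFree_bar] at h2
    have := congrArg FreeGroup.toWord h2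
    simp only [Letter.toFree, FreeGroup.mul_mk, FreeGroup.toWord_mk] at this
    have e1 : D.src.1 ≠ E.tgt.1 := fun h => hE (h.symm.trans hs.symm)
    have e2 : D.src.1 ≠ D.tgt.1 := fun h => hD h.symm
    simp [FreeGroup.reduce.cons, Letter.bar, e1, e2, e2.symm] at this

end Act

/-! ## The admissible set `𝒮` -/

section Admissible

variable {X : Type u}

/-- `f_1 ⁻¹(x)` is finite for every `x ∈ X^±`. -/
def S0 (f : Word (Elem X)) : Prop :=
  ∀ x : Letter X, {s | (f.letter s).src = x}.Finite

/-- There is no injective order preserving map `φ : ℕ → S` with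
`f_1 (φ (n + 1)) = (f_2 (φ n))^{±1}` for all `n`. -/
def S1 (f : Word (Elem X)) : Prop :=
  ¬ ∃ φ : ℕ → f.pos, StrictMono φ ∧
    ∀ n, (f.letter (φ (n + 1))).src = (f.letter (φ n)).tgt ∨
      (f.letter (φ (n + 1))).src = (f.letter (φ n)).tgt.bar

theorem S1.of_embedding {f g : Word (Elem X)} (e : g.pos ↪o f.pos)
    (he : ∀ s, g.letter s = f.letter (e s)) (hf : S1 f) : S1 g := by
  rintro ⟨φ, hφ, h⟩
  refine hf ⟨e ∘ φ, e.strictMono.comp hφ, fun n => ?_⟩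
  have := h n
  rw [he, he] at this
  exact this

theorem S1.concat {f g : Word (Elem X)} (hf : S1 f) (hg : S1 g) : S1 (f.concat g) := by
  rintro ⟨φ, hφ, h⟩
  by_cases H : ∃ n s, φ n = toLex (Sum.inr s)
  · obtain ⟨n, s, hs⟩ := H
    have H' : ∀ m, ∃ t, φ (n + m) = toLex (Sum.inr t) := by
      intro m
      have hle : φ n ≤ φ (n + m) := hφ.monotone (Nat.le_add_right _ _)
      rw [hs] at hle
      rcases ht : φ (n + m) with t | t
      · rw [ht] at hle
        exact absurd hle Sum.Lex.not_inr_le_inl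
      · exact ⟨t, rfl⟩
    choose ψ hψ using H'
    refine hg ⟨ψ, ?_, ?_⟩
    · intro a b hab
      have := hφ (Nat.add_lt_add_left hab n)
      rw [hψ, hψ] at this
      exact Sum.Lex.inr_lt_inr_iff.1 this
    · intro m
      have := h (n + m)
      rw [add_assoc, hψ, hψ] at this
      exact this
  · have H' : ∀ m, ∃ t, φ m = toLex (Sum.inl t) := by
      intro m
      rcases ht : φ m with t | t
      · exact ⟨t, rfl⟩
      · exact absurd ⟨m, t, ht⟩ H
    choose ψ hψ using H'
    refine hf ⟨ψ, ?_, ?_⟩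
    · intro a b hab
      have := hφ hab
      rw [hψ, hψ] at this
      exact Sum.Lex.inl_lt_inl_iff.1 this
    · intro m
      have := h m
      rw [hψ, hψ] at this
      exact this

theorem bar_concat_letter (f g : Word (Elem X)) :
    ∃ e : (f.concat g).bar.pos ↪o (g.bar.concat f.bar).pos,
      ∀ s, (f.concat g).bar.letter s = (g.bar.concat f.bar).letter (e s) := by
  refine ⟨OrderEmbedding.ofMapLEIff (fun s => toLex (Sum.elim
      (fun a => Sum.inr (OrderDual.toDual a)) (fun a => Sum.inl (OrderDual.toDual a))
      (ofLex (OrderDual.ofDual s)))) ?_, ?_⟩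
  · rintro (a | a) (b | b)
    · refine Sum.Lex.inr_le_inr_iff.trans ?_
      exact ⟨fun h => Sum.Lex.inl_le_inl_iff.2 h, fun h => by
        have h' := Sum.Lex.inl_le_inl_iff.1 h
        exact h'⟩
    · exact iff_of_false Sum.Lex.not_inr_le_inl (fun h => Sum.Lex.not_inr_le_inl h)
    · exact iff_of_true (Sum.Lex.inl_le_inr _ _) (Sum.Lex.inl_le_inr _ _)
    · refine Sum.Lex.inl_le_inl_iff.trans ?_
      exact ⟨fun h => Sum.Lex.inr_le_inr_iff.2 h, fun h => by
        have h' := Sum.Lex.inr_le_inr_iff.1 h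
        exact h'⟩
  · rintro (s | s) <;> rfl

/-- The admissible set `𝒮 = {f | f ∈ 𝒮₀ and f, f⁻¹ ∈ 𝒮₁}`. -/
def nielsenWords (X : Type u) : AdmissibleSet (Elem X) where
  carrier := {f | S0 f ∧ S1 f ∧ S1 f.bar}
  nonempty := ⟨Word.empty _, fun _ => Set.toFinite (α := PEmpty) _,
    fun ⟨φ, _⟩ => (φ 0).elim, fun ⟨φ, _⟩ => PEmpty.elim (φ 0)⟩
  concat_mem := by
    rintro f g ⟨hf0, hf1, hf2⟩ ⟨hg0, hg1, hg2⟩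
    refine ⟨fun x => ?_, hf1.concat hg1, ?_⟩
    · refine (((hf0 x).image (fun s => toLex (Sum.inl s))).union
        ((hg0 x).image (fun s => toLex (Sum.inr s)))).subset ?_
      rintro (s | s) hs
      · exact Or.inl ⟨s, hs, rfl⟩
      · exact Or.inr ⟨s, hs, rfl⟩
    · obtain ⟨e, he⟩ := bar_concat_letter f g
      exact (hg2.concat hf2).of_embedding e he
  bar_mem := by
    rintro f ⟨h0, h1, h2⟩
    refine ⟨fun x => h0 x, h2, ?_⟩
    exact S1.of_embedding (f := f) (g := f.bar.bar)
      ⟨⟨fun s => OrderDual.ofDual (OrderDual.ofDual s), fun _ _ h => h⟩, Iff.rfl⟩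
      (fun s => inv_inv _) h1
  cancel_mem := by
    rintro f g ⟨h0, h1, h2⟩ ⟨T, star, e, -, he, -⟩
    refine ⟨fun x => ?_, h1.of_embedding e he, ?_⟩
    · refine ((h0 x).preimage e.injective.injOn).subset ?_
      intro s hs
      have h : (g.letter s).src = x := hs
      rw [he] at h
      exact h
    · exact S1.of_embedding (f := f.bar) (g := g.bar) e.dual (fun s => congrArg (·⁻¹) (he s)) h2

end Admissible

/-! ## The homomorphism `Ψ` -/

section Psi

variable {X : Type u}

/-- For a finite set `C = {s_1 < ... < s_n}` of positions of `f`, the automorphism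
`E_C = f(s_1) f(s_2) ... f(s_n)`. -/
noncomputable def finProd (f : Word (Elem X)) (C : Finset f.pos) : RAut X :=
  (C.sort.map fun s => (f.letter s).toAut).prod

/-- Membership in `C(f, x)`, for `x ∈ X` (with `C(f, x) = C(f, x⁻¹)`): the set that is swept out
by the sequence `s_1 < s_2 < ...`, where `s_{k+1}` is the least `s > s_k` such that `f_1 s` lies in
`A_k = {x, x⁻¹} ∪ {(f_2 s_1)^{±1}, ..., (f_2 s_k)^{±1}}`. Thus `s` belongs to `C(f, x)` if and only
if `f_1 s` is `x^{±1}` or is `(f_2 t)^{±1}` for some `t < s` in `C(f, x)`. -/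
inductive Reach (f : Word (Elem X)) (x : X) : f.pos → Prop
  | base (s : f.pos) : (f.letter s).src.1 = x → Reach f x s
  | step (t s : f.pos) : Reach f x t → t < s → (f.letter s).src.1 = (f.letter t).tgt.1 →
      Reach f x s

theorem S0.finite {f : Word (Elem X)} (h : S0 f) (x : X) :
    {s | (f.letter s).src.1 = x}.Finite := by
  refine ((h (x, true)).union (h (x, false))).subset ?_
  intro s hs
  rcases hb : (f.letter s).src with ⟨y, _ | _⟩
  · right
    have : y = x := by simpa [hb] using hs
    simp [hb, this]
  · left
    have : y = x := by simpa [hb] using hs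
    simp [hb, this]

theorem reach_finite {f : Word (Elem X)} (hf : f ∈ (nielsenWords X).carrier) (x : X) :
    {s | Reach f x s}.Finite := by
  obtain ⟨h0, h1, -⟩ := hf
  let r : f.pos → f.pos → Prop := fun s t => t < s ∧ (f.letter s).src.1 = (f.letter t).tgt.1
  have wf : WellFounded r := by
    rw [wellFounded_iff_isEmpty_descending_chain]
    refine ⟨fun ⟨φ, hφ⟩ => h1 ⟨φ, strictMono_nat_of_lt_succ fun n => (hφ n).1, fun n => ?_⟩⟩
    exact (Letter.eq_or_eq_bar_iff _ _).2 (hφ n).2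
  have fin : ∀ t, {s | Relation.ReflTransGen (fun a b => r b a) t s}.Finite := by
    intro t
    induction t using wf.induction with
    | _ t ih =>
      have hsucc : {s | r s t}.Finite := (h0.finite _).subset fun s hs => hs.2
      refine ((Set.finite_singleton t).union (hsucc.biUnion ih)).subset ?_
      intro s hs
      rcases Relation.ReflTransGen.cases_head hs with h | ⟨b, hb, hbs⟩
      · exact Or.inl h.symm
      · exact Or.inr (Set.mem_biUnion (x := b) hb hbs)
  refine ((h0.finite x).biUnion fun t _ => fin t).subset ?_
  intro s hs
  induction hs with
  | base s h => exact Set.mem_biUnion (x := s) h Relation.ReflTransGen.refl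
  | step t s _ hts hst ih =>
    obtain ⟨b, hb, hbt⟩ := Set.mem_iUnion₂.1 ih
    exact Set.mem_biUnion (x := b) hb (Relation.ReflTransGen.tail hbt ⟨hts, hst⟩)

/-- The finite set of positions `C(f, x)`. -/
noncomputable def reachSet {f : Word (Elem X)} (hf : f ∈ (nielsenWords X).carrier) (x : X) :
    Finset f.pos :=
  (reach_finite hf x).toFinset

/-- The endomorphism `α_f` of `F(X)` defined by the word `f ∈ 𝒮`: `x α_f = x E_{C(f, x)}`. -/
noncomputable def alpha {f : Word (Elem X)} (hf : f ∈ (nielsenWords X).carrier) :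
    FreeGroup X →* FreeGroup X :=
  FreeGroup.lift fun x => act (FreeGroup.of x) (finProd f (reachSet hf x))

theorem Elem.act_of_mem_closure (E : Elem X) {V : Set X} (hV : E.src.1 ∉ V) {w : FreeGroup X}
    (hw : w ∈ Subgroup.closure (FreeGroup.of '' V)) : act w E.toAut = w := by
  induction hw using Subgroup.closure_induction with
  | mem w h =>
    obtain ⟨z, hz, rfl⟩ := h
    exact E.act_of_ne z fun h => hV (h ▸ hz)
  | one => exact map_one E.toAut.unop
  | mul a b _ _ ha hb => rw [mul_act, ha, hb]
  | inv a _ ha => rw [inv_act, ha]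

theorem toFree_mem_closure {V : Set X} (a : Letter X) (ha : a.1 ∈ V) :
    a.toFree ∈ Subgroup.closure (FreeGroup.of '' V) := by
  have h : FreeGroup.of a.1 ∈ Subgroup.closure (FreeGroup.of '' V) :=
    Subgroup.subset_closure ⟨_, ha, rfl⟩
  rcases a with ⟨z, _ | _⟩
  · exact inv_mem h
  · exact h

theorem Elem.act_mem_closure (E : Elem X) {V : Set X} {w : FreeGroup X}
    (hw : w ∈ Subgroup.closure (FreeGroup.of '' V)) :
    act w E.toAut ∈ Subgroup.closure (FreeGroup.of '' (insert E.tgt.1 V)) := by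
  induction hw using Subgroup.closure_induction with
  | mem w h =>
    obtain ⟨z, hz, rfl⟩ := h
    by_cases hzE : z = E.src.1
    · have hs : act E.src.toFree E.toAut ∈
          Subgroup.closure (FreeGroup.of '' (insert E.tgt.1 V)) := by
        rw [E.act_src]
        exact mul_mem (toFree_mem_closure _ (Or.inr (hzE ▸ hz)))
          (toFree_mem_closure _ (Or.inl rfl))
      obtain ⟨⟨x, i⟩, y, h1, h2⟩ := E
      subst hzE
      cases i
      · have := inv_mem hs
        rw [← inv_act] at this
        exact this
      · exact hs
    · rw [E.act_of_ne z hzE]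
      exact Subgroup.subset_closure ⟨z, Or.inr hz, rfl⟩
  | one => rw [show act 1 E.toAut = 1 from map_one E.toAut.unop]; exact one_mem _
  | mul a b _ _ ha hb => rw [mul_act]; exact mul_mem ha hb
  | inv a _ ha => rw [inv_act]; exact inv_mem ha

theorem act_prod_filter (f : Word (Elem X)) (P : f.pos → Prop) [DecidablePred P]
    (l : List f.pos) : ∀ (V : Set X) (w : FreeGroup X),
    w ∈ Subgroup.closure (FreeGroup.of '' V) →
    (∀ s ∈ l, (f.letter s).src.1 ∈ V → P s) →
    l.Pairwise (fun t s => P t → (f.letter s).src.1 = (f.letter t).tgt.1 → P s) →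
    act w (l.map fun s => (f.letter s).toAut).prod =
      act w ((l.filter P).map fun s => (f.letter s).toAut).prod := by
  induction l with
  | nil => intros; rfl
  | cons t l ih =>
    intro V w hw h1 h2
    rw [List.pairwise_cons] at h2
    by_cases ht : P t
    · simp only [List.filter_cons, ht, decide_true, if_true, List.map_cons, List.prod_cons,
        act_mul]
      refine ih _ _ ((f.letter t).act_mem_closure hw) ?_ h2.2
      rintro s hs (h | h)
      · exact h2.1 s hs ht h
      · exact h1 s (List.mem_cons_of_mem _ hs) h
    · simp only [List.filter_cons, ht, decide_false, List.map_cons, List.prod_cons, act_mul]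
      rw [(f.letter t).act_of_mem_closure (fun h => ht (h1 t List.mem_cons_self h)) hw]
      exact ih V w hw (fun s hs => h1 s (List.mem_cons_of_mem _ hs)) h2.2

theorem sort_eq_of {α : Type u} [LinearOrder α] {C : Finset α} {l : List α}
    (h1 : l.Pairwise (· < ·)) (h2 : ∀ a, a ∈ l ↔ a ∈ C) : C.sort = l := by
  refine List.Perm.eq_of_pairwise' (r := (· ≤ ·)) (Finset.pairwise_sort C _)
    (h1.imp fun h => h.le) ?_
  rw [List.perm_ext_iff_of_nodup (Finset.sort_nodup C _) (h1.imp fun h => h.ne)]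
  intro a
  rw [Finset.mem_sort, h2]

/-- Every finite set of positions containing `C(f, x)` computes `x α_f`. -/
theorem act_finProd_of_subset {f : Word (Elem X)} (hf : f ∈ (nielsenWords X).carrier) (x : X)
    {C : Finset f.pos} (hC : reachSet hf x ⊆ C) :
    act (FreeGroup.of x) (finProd f C) = alpha hf (FreeGroup.of x) := by
  classical
  rw [alpha, FreeGroup.lift_apply_of, finProd, finProd]
  refine (act_prod_filter f (Reach f x) (C.sort (· ≤ ·)) {x} (FreeGroup.of x)
      (Subgroup.subset_closure ⟨x, rfl, rfl⟩) (fun s _ h => Reach.base s h)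
      ((Finset.sortedLT_sort C).pairwise.imp fun h hr hs => Reach.step _ _ hr h hs)).trans ?_
  rw [sort_eq_of (C := reachSet hf x) ((Finset.sortedLT_sort C).pairwise.filter _)]
  intro a
  have : a ∈ reachSet hf x ↔ Reach f x a := by simp [reachSet]
  rw [this, List.mem_filter, Finset.mem_sort]
  exact ⟨fun h => by simpa using h.2, fun h => ⟨hC (this.2 h), by simpa using h⟩⟩

/-- `w α_f = w E_C` for all sufficiently large finite sets of positions `C`. -/
theorem exists_act_finProd {f : Word (Elem X)} (hf : f ∈ (nielsenWords X).carrier)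
    (w : FreeGroup X) :
    ∃ C₀ : Finset f.pos, ∀ C, C₀ ⊆ C → act w (finProd f C) = alpha hf w := by
  classical
  induction w using FreeGroup.induction_on with
  | C1 => exact ⟨∅, fun C _ => (map_one (finProd f C).unop).trans (map_one (alpha hf)).symm⟩
  | of x => exact ⟨reachSet hf x, fun C hC => act_finProd_of_subset hf x hC⟩
  | inv_of x ih =>
    obtain ⟨C₀, h⟩ := ih
    refine ⟨C₀, fun C hC => ?_⟩
    have := h C hC
    rw [map_inv, ← this]
    exact inv_act _ _
  | mul a b ha hb =>
    obtain ⟨A, hA⟩ := ha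
    obtain ⟨B, hB⟩ := hb
    refine ⟨A ∪ B, fun C hC => ?_⟩
    rw [mul_act, map_mul, hA C (Finset.union_subset_left hC), hB C (Finset.union_subset_right hC)]

theorem finProd_empty (f : Word (Elem X)) : finProd f ∅ = 1 := by
  simp [finProd]

theorem finProd_singleton (f : Word (Elem X)) (s : f.pos) :
    finProd f {s} = (f.letter s).toAut := by
  simp [finProd]

theorem finProd_union (f : Word (Elem X)) {A B : Finset f.pos}
    (h : ∀ a ∈ A, ∀ b ∈ B, a < b) : finProd f (A ∪ B) = finProd f A * finProd f B := by
  rw [finProd, finProd, finProd, ← List.prod_append, ← List.map_append, sort_eq_of]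
  · rw [List.pairwise_append]
    refine ⟨(Finset.sortedLT_sort A).pairwise, (Finset.sortedLT_sort B).pairwise, ?_⟩
    intro a ha b hb
    exact h a ((Finset.mem_sort _).1 ha) b ((Finset.mem_sort _).1 hb)
  · intro a
    simp

theorem finProd_map {f g : Word (Elem X)} (e : g.pos ↪o f.pos)
    (he : ∀ s, g.letter s = f.letter (e s)) (C : Finset g.pos) :
    finProd f (C.map e.toEmbedding) = finProd g C := by
  rw [finProd, finProd, sort_eq_of (l := C.sort.map e)]
  · rw [List.map_map]
    congr 1
    refine List.map_congr_left fun s _ => ?_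
    simp [he]
  · rw [List.pairwise_map]
    exact (Finset.sortedLT_sort C).pairwise.imp fun h => e.lt_iff_lt.2 h
  · intro a
    simp

theorem finProd_erase_pair (f : Word (Elem X)) {C : Finset f.pos} {a b : f.pos} (ha : a ∈ C)
    (hb : b ∈ C) (hab : a < b) (hadj : ∀ c ∈ C, a < c → ¬ c < b)
    (hl : f.letter b = (f.letter a)⁻¹) : finProd f ((C.erase a).erase b) = finProd f C := by
  have e1 : C = C.filter (· < a) ∪ ({a} ∪ ({b} ∪ C.filter (b < ·))) := by
    ext c
    simp only [Finset.mem_union, Finset.mem_filter, Finset.mem_singleton]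
    constructor
    · intro hc
      rcases lt_trichotomy c a with h | h | h
      · exact Or.inl ⟨hc, h⟩
      · exact Or.inr (Or.inl h)
      · rcases lt_trichotomy c b with h' | h' | h'
        · exact absurd h' (hadj c hc h)
        · exact Or.inr (Or.inr (Or.inl h'))
        · exact Or.inr (Or.inr (Or.inr ⟨hc, h'⟩))
    · rintro (h | rfl | rfl | h)
      exacts [h.1, ha, hb, h.1]
  have e2 : (C.erase a).erase b = C.filter (· < a) ∪ C.filter (b < ·) := by
    ext c
    simp only [Finset.mem_union, Finset.mem_filter, Finset.mem_erase]
    constructor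
    · rintro ⟨hcb, hca, hc⟩
      rcases lt_or_gt_of_ne hca with h | h
      · exact Or.inl ⟨hc, h⟩
      · exact Or.inr ⟨hc, lt_of_le_of_ne (not_lt.1 (hadj c hc h)) (Ne.symm hcb)⟩
    · rintro (⟨h1, h2⟩ | ⟨h1, h2⟩)
      · exact ⟨(h2.trans hab).ne, h2.ne, h1⟩
      · exact ⟨h2.ne', (hab.trans h2).ne', h1⟩
  rw [e2]
  conv_rhs => rw [e1]
  rw [finProd_union, finProd_union, finProd_union, finProd_union, finProd_singleton,
    finProd_singleton, hl, Elem.toAut_inv, mul_inv_cancel_left]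
  · intro c hc d hd
    rw [Finset.mem_singleton] at hc
    rw [hc]
    exact (Finset.mem_filter.1 hd).2
  · intro c hc d hd
    rw [Finset.mem_singleton] at hc
    rw [Finset.mem_union, Finset.mem_singleton] at hd
    rcases hd with rfl | hd
    · rwa [hc]
    · rw [hc]
      exact hab.trans (Finset.mem_filter.1 hd).2
  · intro c hc d hd
    have hc := (Finset.mem_filter.1 hc).2
    simp only [Finset.mem_union, Finset.mem_singleton] at hd
    rcases hd with rfl | rfl | hd
    · exact hc
    · exact hc.trans hab
    · exact hc.trans (hab.trans (Finset.mem_filter.1 hd).2)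
  · intro c hc d hd
    exact (Finset.mem_filter.1 hc).2.trans (hab.trans (Finset.mem_filter.1 hd).2)

open Classical in
theorem finProd_cancel (f : Word (Elem X)) (T : Set f.pos) (star : f.pos → f.pos)
    (hT : ∀ t ∈ T, star t ∈ T ∧ star (star t) = t ∧ f.letter (star t) = (f.letter t)⁻¹ ∧
      Set.Icc t (star t) ⊆ T ∧ star '' Set.Icc t (star t) = Set.Icc t (star t)) (n : ℕ) :
    ∀ C : Finset f.pos, (C.filter (· ∈ T)).card = n → (∀ c ∈ C, c ∈ T → star c ∈ C) →
      finProd f C = finProd f (C.filter (· ∉ T)) := by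
  have hne : ∀ t ∈ T, star t ≠ t := by
    intro t ht h
    have := (hT t ht).2.2.1
    rw [h] at this
    exact FreeInvolution.inv_ne_self _ this.symm
  induction n using Nat.strong_induction_on with
  | _ n ih =>
    intro C hn hC
    by_cases hemp : ∃ c ∈ C, c ∈ T
    · have hD : (C.filter fun t => t ∈ T ∧ t < star t).Nonempty := by
        obtain ⟨c, hc, hcT⟩ := hemp
        rcases lt_or_gt_of_ne (hne c hcT) with h | h
        · refine ⟨star c, Finset.mem_filter.2 ⟨hC c hc hcT, (hT c hcT).1, ?_⟩⟩
          rwa [(hT c hcT).2.1]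
        · exact ⟨c, Finset.mem_filter.2 ⟨hc, hcT, h⟩⟩
      obtain ⟨t, ht, hmin⟩ := Finset.exists_min_image _
        (fun t => (C.filter (· ∈ Set.Icc t (star t))).card) hD
      obtain ⟨htC, htT, htlt⟩ := Finset.mem_filter.1 ht
      obtain ⟨h1, h2, h3, h4, h5⟩ := hT t htT
      have hadj : ∀ c ∈ C, t < c → ¬ c < star t := by
        intro c hc htc hct
        have hcT : c ∈ T := h4 ⟨htc.le, hct.le⟩
        obtain ⟨g1, g2, -, -, -⟩ := hT c hcT
        have hmem : star c ∈ Set.Icc t (star t) := h5 ▸ ⟨c, ⟨htc.le, hct.le⟩, rfl⟩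
        have hn1 : star c ≠ t := fun h => hct.ne (by rw [← h, g2])
        have hsub : ∀ a b, t < a → b ≤ star t → C.filter (· ∈ Set.Icc a b) ⊂
            C.filter (· ∈ Set.Icc t (star t)) := by
          intro a b ha hb
          rw [Finset.ssubset_iff_of_subset]
          · refine ⟨t, Finset.mem_filter.2 ⟨htC, le_refl _, htlt.le⟩, fun h => ?_⟩
            exact absurd (Finset.mem_filter.1 h).2.1 (not_le.2 ha)
          · intro d hd
            obtain ⟨hd1, hd2, hd3⟩ := Finset.mem_filter.1 hd
            exact Finset.mem_filter.2 ⟨hd1, ha.le.trans hd2, hd3.trans hb⟩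
        rcases lt_or_gt_of_ne (hne c hcT) with h | h
        · refine absurd (hmin (star c) (Finset.mem_filter.2 ⟨hC c hc hcT, g1, by rwa [g2]⟩)) ?_
          rw [g2]
          exact not_le.2 (Finset.card_lt_card (hsub _ _ (lt_of_le_of_ne hmem.1 hn1.symm) hct.le))
        · refine absurd (hmin c (Finset.mem_filter.2 ⟨hc, hcT, h⟩)) ?_
          exact not_le.2 (Finset.card_lt_card (hsub _ _ htc hmem.2))
      rw [← finProd_erase_pair f htC (hC t htC htT) htlt hadj h3, ih _ _ _ rfl]
      · congr 1
        ext c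
        simp only [Finset.mem_filter, Finset.mem_erase]
        constructor
        · rintro ⟨⟨-, -, h⟩, h'⟩
          exact ⟨h, h'⟩
        · rintro ⟨h, h'⟩
          exact ⟨⟨fun e => h' (e ▸ h1), fun e => h' (e ▸ htT), h⟩, h'⟩
      · intro c hc hcT
        simp only [Finset.mem_erase] at hc ⊢
        obtain ⟨q1, q2, q3⟩ := hc
        have g2 := (hT c hcT).2.1
        refine ⟨fun h => q2 ?_, fun h => q1 ?_, hC c q3 hcT⟩
        · rw [← g2, h, h2]
        · rw [← g2, h]
      · rw [← hn]
        refine Finset.card_lt_card ((Finset.ssubset_iff_of_subset ?_).2 ⟨t, ?_, ?_⟩)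
        · intro c hc
          simp only [Finset.mem_filter, Finset.mem_erase] at hc ⊢
          exact ⟨hc.1.2.2, hc.2⟩
        · exact Finset.mem_filter.2 ⟨htC, htT⟩
        · simp
    · congr 1
      ext c
      simp only [Finset.mem_filter]
      exact ⟨fun h => ⟨h, fun h' => hemp ⟨c, h, h'⟩⟩, fun h => h.1⟩

/-- Cancellation does not change the endomorphism. -/
theorem alpha_eq_of_cancels {f g : Word (Elem X)} (hf : f ∈ (nielsenWords X).carrier)
    (hg : g ∈ (nielsenWords X).carrier) (h : Word.Cancels f g) : alpha hf = alpha hg := by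
  classical
  obtain ⟨T, star, e, hr, he, hT⟩ := h
  ext x
  obtain ⟨A, hA⟩ := exists_act_finProd hf (FreeGroup.of x)
  obtain ⟨B, hB⟩ := exists_act_finProd hg (FreeGroup.of x)
  let C₀ := A ∪ B.map e.toEmbedding
  let C := C₀ ∪ (C₀.filter (· ∈ T)).image star
  have hC : ∀ c ∈ C, c ∈ T → star c ∈ C := by
    intro c hc hcT
    rcases Finset.mem_union.1 hc with h | h
    · exact Finset.mem_union_right _ (Finset.mem_image_of_mem _ (Finset.mem_filter.2 ⟨h, hcT⟩))
    · obtain ⟨d, hd, rfl⟩ := Finset.mem_image.1 h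
      obtain ⟨hd1, hd2⟩ := Finset.mem_filter.1 hd
      rw [(hT d hd2).2.1]
      exact Finset.mem_union_left _ hd1
  have hmap : C.filter (· ∉ T) = (C.preimage e e.injective.injOn).map e.toEmbedding := by
    ext c
    have hc := Set.ext_iff.1 hr c
    simp only [Finset.mem_filter, Finset.mem_map, Finset.mem_preimage]
    constructor
    · rintro ⟨h1, h2⟩
      obtain ⟨d, rfl⟩ := hc.2 h2
      exact ⟨d, h1, rfl⟩
    · rintro ⟨d, h1, rfl⟩
      exact ⟨h1, hc.1 ⟨d, rfl⟩⟩
  rw [← hA C (fun c hc => Finset.mem_union_left _ (Finset.mem_union_left _ hc)),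
    ← hB (C.preimage e e.injective.injOn), ← finProd_map e he, ← hmap,
    finProd_cancel f T star hT _ C rfl hC]
  intro b hb
  rw [Finset.mem_preimage]
  exact Finset.mem_union_left _ (Finset.mem_union_right _
    (Finset.mem_map.2 ⟨b, hb, rfl⟩))

/-- `α_{f g} = α_f α_g`: first `α_f`, then `α_g`. -/
theorem alpha_concat {f g : Word (Elem X)} (hf : f ∈ (nielsenWords X).carrier)
    (hg : g ∈ (nielsenWords X).carrier) :
    alpha ((nielsenWords X).concat_mem hf hg) = (alpha hg).comp (alpha hf) := by
  classical
  ext x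
  let il : f.pos ↪o (f.concat g).pos :=
    ⟨⟨fun s => toLex (Sum.inl s), fun _ _ h => Sum.inl_injective h⟩, Sum.Lex.inl_le_inl_iff⟩
  let ir : g.pos ↪o (f.concat g).pos :=
    ⟨⟨fun s => toLex (Sum.inr s), fun _ _ h => Sum.inr_injective h⟩, Sum.Lex.inr_le_inr_iff⟩
  obtain ⟨A, hA⟩ := exists_act_finProd hf (FreeGroup.of x)
  obtain ⟨B, hB⟩ := exists_act_finProd hg (alpha hf (FreeGroup.of x))
  obtain ⟨D, hD⟩ := exists_act_finProd ((nielsenWords X).concat_mem hf hg) (FreeGroup.of x)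
  let A' := A ∪ D.preimage il il.injective.injOn
  let B' := B ∪ D.preimage ir ir.injective.injOn
  rw [← hD (A'.map il.toEmbedding ∪ B'.map ir.toEmbedding), finProd_union,
    finProd_map il (fun _ => rfl), finProd_map ir (fun _ => rfl), act_mul,
    hA A' Finset.subset_union_left, hB B' Finset.subset_union_left]
  · rfl
  · intro a ha b hb
    obtain ⟨a, -, rfl⟩ := Finset.mem_map.1 ha
    obtain ⟨b, -, rfl⟩ := Finset.mem_map.1 hb
    exact Sum.Lex.inl_lt_inr a b
  · rintro (s | s) hs
    · exact Finset.mem_union_left _ (Finset.mem_map.2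
        ⟨s, Finset.mem_union_right _ (Finset.mem_preimage.2 hs), rfl⟩)
    · exact Finset.mem_union_right _ (Finset.mem_map.2
        ⟨s, Finset.mem_union_right _ (Finset.mem_preimage.2 hs), rfl⟩)

theorem alpha_empty : alpha (nielsenWords X).empty_mem = MonoidHom.id _ := by
  ext x
  obtain ⟨A, hA⟩ := exists_act_finProd (nielsenWords X).empty_mem (FreeGroup.of x)
  have hAe : A = ∅ := Finset.eq_empty_of_forall_notMem fun a => PEmpty.elim a
  rw [← hA A subset_rfl, hAe, finProd_empty]
  rfl

theorem alpha_bar_concat {f : Word (Elem X)} (hf : f ∈ (nielsenWords X).carrier) :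
    (alpha hf).comp (alpha ((nielsenWords X).bar_mem hf)) = MonoidHom.id _ := by
  rw [← alpha_concat, alpha_eq_of_cancels _ (nielsenWords X).empty_mem (Word.cancels_bar_concat f),
    alpha_empty]

theorem alpha_concat_bar {f : Word (Elem X)} (hf : f ∈ (nielsenWords X).carrier) :
    (alpha ((nielsenWords X).bar_mem hf)).comp (alpha hf) = MonoidHom.id _ := by
  have hb := (nielsenWords X).bar_mem hf
  have h := alpha_bar_concat hb
  have hbb : Word.Cancels f.bar.bar f := Word.Cancels.of_iso
    ⟨⟨fun s => OrderDual.toDual (OrderDual.toDual s),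
      fun s => OrderDual.ofDual (OrderDual.ofDual s), fun _ => rfl, fun _ => rfl⟩, Iff.rfl⟩
    fun _ => (inv_inv _).symm
  rwa [alpha_eq_of_cancels _ hf hbb] at h

/-- The automorphism `α_f` of `F(X)` defined by a word `f ∈ 𝒮`. -/
noncomputable def alphaAut {f : Word (Elem X)} (hf : f ∈ (nielsenWords X).carrier) : RAut X :=
  MulOpposite.op ((alpha hf).toMulEquiv (alpha ((nielsenWords X).bar_mem hf))
    (alpha_concat_bar hf) (alpha_bar_concat hf))

theorem act_alphaAut {f : Word (Elem X)} (hf : f ∈ (nielsenWords X).carrier) (w : FreeGroup X) :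
    act w (alphaAut hf) = alpha hf w := rfl

variable (X) in
/-- The homomorphism `Ψ : BF(ℰ, 𝒮) → Aut(F(X))`, `Ψ [f] = α_f`. -/
noncomputable def Psi : BF (nielsenWords X) →* RAut X :=
  MonoidHom.mk' (Quot.lift (fun f => alphaAut f.2) fun f g h => RAut.ext fun w => by
      rw [act_alphaAut, act_alphaAut, alpha_eq_of_cancels f.2 g.2 h])
    (by
      rintro ⟨f⟩ ⟨g⟩
      exact RAut.ext fun w => DFunLike.congr_fun (alpha_concat f.2 g.2) w)

theorem Psi_mk {f : Word (Elem X)} (hf : f ∈ (nielsenWords X).carrier) :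
    Psi X (BF.mk _ f hf) = alphaAut hf := rfl

end Psi

end BigFree

namespace FreeGroup

variable {α : Type*}

/-! Why the theorem holds. Call `E_{xy}` a move with source `x` and target `y`. If `g i` is a finite
product of moves with sources in a block `[m i, m (i+1))` and targets below `m (i+1)`, then the
infinite product `... g₂ g₁ g₀` is spelled by a word in `𝒮`, and on the generators below `m i` its
image under `Ψ` agrees with `g (i-1) ... g₀` (`exists_mem_range_Psi`). It therefore suffices to find
two such products `δ`, `ε` with `δ α = ε`.

The finite input is a Nielsen reduction with restricted sources. If `α` fixes the generators below
`k`, then multiplying it on the left by finitely many moves with sources in some `[k, N)` and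
targets below `N` makes it fix the generators below any given `n ≥ k` (`exists_mul_fixes_lt`). One
generator is gained at a time (`exists_mul_fixes`): among all products of allowed moves with `α`,
take one of least measure. Its images of the generators in a suitable finite set are Nielsen
reduced, so a product of `l` of them without trivial adjacent products has length at least `l`
(`length_le_norm_prod`). A generator in the subgroup they generate must then be one of them, up to
inversion.

Multiplying on one side only would give overlapping blocks. Instead, the automorphism is inverted
after each stage: `β 0 = α` and `β (j+1) = (γ j * β j)⁻¹`, where `β j` fixes the generators below `n
j` and `γ j` has its sources in `[n j, n (j+2))`. The blocks of the even `γ j` are disjoint and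
consecutive, as are those of the odd ones. Since `(γ (2i-2) ... γ 2 γ 0) α = β (2i) (γ (2i-1) ... γ
3 γ 1)` and `β (2i)` fixes more and more generators, the limit is `δ α = ε`. -/

theorem drop_eq_invRev_take (w : List (α × Bool)) (s : ℕ) :
    w.drop s = invRev ((invRev w).take (w.length - s)) := by
  rcases le_total s w.length with h | h
  · conv_rhs => rw [← List.take_append_drop s w, invRev_append,
      List.take_left' (by simp [invRev_length]), invRev_invRev]
  · simp [h]

theorem lex_append_of_length_eq {β : Type*} {r : β → β → Prop} {l m : List β}
    (h : List.Lex r l m) (hl : l.length = m.length) (k : List β) :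
    List.Lex r (l ++ k) (m ++ k) := by
  induction h with
  | nil => simp at hl
  | cons _ ih => exact List.Lex.cons (ih (by simpa using hl))
  | rel h => exact List.Lex.rel h

/-! ### Common prefixes of reduced words and the Gromov product. -/

variable [DecidableEq α]

/-- The length of the longest common prefix of two lists. -/
def lcpLength : List (α × Bool) → List (α × Bool) → ℕ
  | a :: l, b :: m => if a = b then lcpLength l m + 1 else 0
  | _, _ => 0

theorem lcpLength_comm (l m : List (α × Bool)) : lcpLength l m = lcpLength m l := by
  induction l generalizing m with
  | nil => cases m <;> simp [lcpLength]
  | cons a l ih =>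
    cases m with
    | nil => simp [lcpLength]
    | cons b m => simp [lcpLength, ih m, eq_comm]

theorem lcpLength_le_left (l m : List (α × Bool)) : lcpLength l m ≤ l.length := by
  induction l generalizing m with
  | nil => cases m <;> simp [lcpLength]
  | cons a l ih =>
    cases m with
    | nil => simp [lcpLength]
    | cons b m =>
      have := ih m
      simp only [lcpLength, List.length_cons]
      split <;> omega

theorem take_lcpLength (l m : List (α × Bool)) :
    l.take (lcpLength l m) = m.take (lcpLength l m) := by
  induction l generalizing m with
  | nil => cases m <;> simp [lcpLength]
  | cons a l ih =>
    cases m with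
    | nil => simp [lcpLength]
    | cons b m =>
      simp only [lcpLength]
      split
      · simp_all
      · simp

/-- The ultrametric inequality: both pairs agree with `m` on the shorter of the two common prefixes.
-/
theorem min_lcpLength_le (l m k : List (α × Bool)) :
    min (lcpLength l m) (lcpLength m k) ≤ lcpLength l k := by
  induction l generalizing m k with
  | nil => cases m <;> simp [lcpLength]
  | cons a l ih =>
    cases m with
    | nil => simp [lcpLength]
    | cons b m =>
      cases k with
      | nil => simp [lcpLength]
      | cons c k =>
        have := ih m k
        simp only [lcpLength]
        split_ifs <;> simp_all

theorem norm_mk_of_isReduced {l : List (α × Bool)} (h : IsReduced l) :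
    norm (mk l) = l.length := by
  rw [norm, toWord_mk, h.reduce_eq]

/-- Reduction yields a sublist, which is everything as soon as no length is lost. -/
theorem toWord_mk_of_norm {l : List (α × Bool)} (h : norm (mk l) = l.length) :
    (mk l).toWord = l := by
  rw [toWord_mk]
  rw [norm, toWord_mk] at h
  exact (reduce.red : Red l (reduce l)).sublist.eq_of_length h

theorem isReduced_invRev {l : List (α × Bool)} (h : IsReduced l) : IsReduced (invRev l) := by
  rw [isReduced_iff_reduce_eq, reduce_invRev, h.reduce_eq]

/-- Exactly the common prefix cancels: behind it the first letters differ, so the junction is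
reduced. -/
theorem norm_inv_mul_mk {l m : List (α × Bool)} (hl : IsReduced l) (hm : IsReduced m) :
    norm ((mk l)⁻¹ * mk m) + 2 * lcpLength l m = l.length + m.length := by
  induction l generalizing m with
  | nil =>
    have : (mk ([] : List (α × Bool)))⁻¹ * mk m = mk m := by simp [mul_mk]
    cases m <;> simp [lcpLength, norm_mk_of_isReduced hm]
  | cons a l ih =>
    cases m with
    | nil =>
      have : (mk (a :: l))⁻¹ * mk [] = (mk (a :: l))⁻¹ := by simp [mul_mk]
      rw [this, norm_inv_eq, norm_mk_of_isReduced hl]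
      simp [lcpLength]
    | cons b m =>
      by_cases hab : a = b
      · subst hab
        have h1 : mk (a :: l) = mk [a] * mk l := by simp [mul_mk]
        have h2 : mk (a :: m) = mk [a] * mk m := by simp [mul_mk]
        have := ih (hl.infix ⟨[a], [], by simp⟩) (m := m) (hm.infix ⟨[a], [], by simp⟩)
        rw [h1, h2, mul_inv_rev, mul_assoc, inv_mul_cancel_left]
        simp only [lcpLength, if_true, List.length_cons]
        omega
      · have hr : IsReduced (invRev (a :: l) ++ b :: m) := by
          rw [IsReduced, List.isChain_append]
          refine ⟨isReduced_invRev hl, hm, ?_⟩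
          intro x hx y hy
          simp [invRev] at hx hy
          subst hx hy
          simp only [Prod.ext_iff, not_and] at hab
          intro h
          cases h3 : a.2 <;> cases h4 : b.2 <;> simp_all
        rw [inv_mk, mul_mk, norm_mk_of_isReduced hr]
        simp [lcpLength, hab]

/-- The Gromov product of two elements of a free group: the length of the common prefix of their
reduced words. -/
def gromov (g h : FreeGroup α) : ℕ := lcpLength g.toWord h.toWord

theorem gromov_comm (g h : FreeGroup α) : gromov g h = gromov h g := lcpLength_comm _ _

theorem norm_inv_mul (g h : FreeGroup α) : norm (g⁻¹ * h) + 2 * gromov g h = norm g + norm h := by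
  have := norm_inv_mul_mk (isReduced_toWord (x := g)) (isReduced_toWord (x := h))
  rwa [mk_toWord, mk_toWord] at this

theorem norm_mul_add (g h : FreeGroup α) : norm (g * h) + 2 * gromov g⁻¹ h = norm g + norm h := by
  have := norm_inv_mul g⁻¹ h
  rwa [inv_inv, norm_inv_eq] at this

theorem gromov_le_left (g h : FreeGroup α) : gromov g h ≤ norm g := lcpLength_le_left _ _

theorem min_gromov_le (g h k : FreeGroup α) : min (gromov g h) (gromov h k) ≤ gromov g k :=
  min_lcpLength_le _ _ _

/-- An element is the quotient of its two halves. -/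
theorem eq_mk_take_mul_inv (g : FreeGroup α) (s : ℕ) :
    g = mk (g.toWord.take s) * (mk (g⁻¹.toWord.take (norm g - s)))⁻¹ := by
  conv_lhs => rw [← mk_toWord (x := g), ← List.take_append_drop s g.toWord]
  rw [← mul_mk, drop_eq_invRev_take, toWord_inv, inv_mk]
  rfl

/-- A nontrivial element loses less than half of each factor in its square. Otherwise `g` and `g⁻¹`
share their first halves: for even length this gives `g = p p⁻¹ = 1`, for odd length the middle
letter would be its own inverse. -/
theorem two_mul_gromov_inv_self_lt {g : FreeGroup α} (hg : g ≠ 1) :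
    2 * gromov g⁻¹ g < norm g := by
  by_contra! h
  have key : ∀ s ≤ gromov g⁻¹ g, g⁻¹.toWord.take s = g.toWord.take s := by
    intro s hs
    have := congrArg (List.take s) (take_lcpLength g⁻¹.toWord g.toWord)
    rwa [List.take_take, List.take_take, show lcpLength g⁻¹.toWord g.toWord = gromov g⁻¹ g from rfl,
      min_eq_left hs] at this
  obtain ⟨s, hs | hs⟩ : ∃ s, norm g = 2 * s ∨ norm g = 2 * s + 1 :=
    ⟨norm g / 2, by omega⟩
  · apply hg
    rw [eq_mk_take_mul_inv g s, key _ (by omega), hs, show 2 * s - s = s by omega, mul_inv_cancel]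
  · have hl : g.toWord.length = 2 * s + 1 := hs
    -- The common prefix has length at least `s + 1`, hence reaches the middle letter, at index `s`.
    have h1 := congrArg (fun l => l[s]?) (key (s + 1) (by omega))
    have h2 : 2 * s + 1 - 1 - s = s := by omega
    simp only [toWord_inv, invRev, List.getElem?_take, lt_add_iff_pos_right, zero_lt_one,
      if_true] at h1
    rw [List.getElem?_reverse (by simp [hl]; omega), List.getElem?_map, List.length_map, hl, h2,
      List.getElem?_eq_getElem (by omega)] at h1
    simp [Prod.ext_iff] at h1

/-! ### Left halves, used to break ties in the Nielsen reduction. -/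

/-- The first half of the reduced word of `g`. -/
def leftHalf (g : FreeGroup α) : List (α × Bool) := g.toWord.take (norm g / 2)

/-- If `h = p q⁻¹` with `p` and `q` of equal length and `p` is a prefix of `g`, which is at least
twice as long, then `h⁻¹ g` arises from `g` by replacing `p` with `q`. -/
theorem toWord_inv_mul_of_half {g h : FreeGroup α} {n : ℕ} (hn : gromov g h = n)
    (hh : norm h = 2 * n) :
    g.toWord = h.toWord.take n ++ g.toWord.drop n ∧
      (h⁻¹ * g).toWord = h⁻¹.toWord.take n ++ g.toWord.drop n := by
  have h1 : g.toWord.take n = h.toWord.take n := hn ▸ take_lcpLength g.toWord h.toWord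
  have h2 : g.toWord = h.toWord.take n ++ g.toWord.drop n := by
    rw [← h1, List.take_append_drop]
  refine ⟨h2, ?_⟩
  have h3 := eq_mk_take_mul_inv h n
  rw [hh, show 2 * n - n = n by omega] at h3
  have h4 : h⁻¹ * g = mk (h⁻¹.toWord.take n ++ g.toWord.drop n) := by
    have h5 : g = mk (h.toWord.take n) * mk (g.toWord.drop n) := by
      rw [mul_mk, ← h2, mk_toWord]
    have h6 := congrArg (·⁻¹) h3
    simp only [mul_inv_rev, inv_inv] at h6
    have h7 := congrArg₂ (· * ·) h6 h5
    simp only [mul_assoc, inv_mul_cancel_left] at h7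
    rw [← mul_mk]
    exact h7
  rw [h4]
  refine toWord_mk_of_norm ?_
  rw [← h4]
  have h5 := norm_inv_mul h g
  have h6 : n ≤ norm g := hn ▸ gromov_le_left g h
  rw [gromov_comm, hn, hh] at h5
  have h7 : g.toWord.length = norm g := rfl
  have h8 : h⁻¹.toWord.length = 2 * n := (norm_inv_eq (x := h)).trans hh
  simp only [List.length_append, List.length_take, List.length_drop]
  omega

theorem leftHalf_of_append {g : FreeGroup α} {p s : List (α × Bool)} (h : g.toWord = p ++ s)
    (hps : p.length ≤ s.length) :
    leftHalf g = p ++ s.take ((p.length + s.length) / 2 - p.length) ∧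
      leftHalf g⁻¹ = (invRev s).take ((p.length + s.length) / 2) := by
  have hn : norm g = p.length + s.length := by rw [norm, h, List.length_append]
  constructor
  · rw [leftHalf, hn, h, List.take_append, List.take_of_length_le]
    omega
  · rw [leftHalf, norm_inv_eq, hn, toWord_inv, h, invRev_append, List.take_append_of_le_length]
    rw [invRev_length]
    omega

/-- As `p` fills at most half of the word, exchanging it for `q` happens inside the left half; the
left half of the inverse is read off from `s` alone. -/
theorem leftHalf_replace {g g' : FreeGroup α} {p q s : List (α × Bool)} (hg : g.toWord = p ++ s)
    (hg' : g'.toWord = q ++ s) (hpq : p.length = q.length) (hps : p.length ≤ s.length) :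
    leftHalf g'⁻¹ = leftHalf g⁻¹ ∧ ∀ r : α × Bool → α × Bool → Prop, List.Shortlex r q p →
      List.Shortlex r (leftHalf g') (leftHalf g) := by
  obtain ⟨h1, h2⟩ := leftHalf_of_append hg hps
  obtain ⟨h3, h4⟩ := leftHalf_of_append hg' (hpq ▸ hps)
  rw [h1, h2, h3, h4, hpq]
  refine ⟨rfl, fun r h => ?_⟩
  rw [List.shortlex_iff_lex hpq.symm] at h
  exact List.Shortlex.of_lex (by simp [hpq]) (lex_append_of_length_eq h hpq.symm _)

/-! ### Lengths of products over a Nielsen reduced set. -/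

/-- In a product of elements of a Nielsen reduced set at least one letter of every factor
survives. -/
theorem length_le_norm_prod_aux {V : Set (FreeGroup α)} (h0 : ∀ x ∈ V, x ≠ 1)
    (h1 : ∀ x ∈ V, ∀ y ∈ V, x * y ≠ 1 → 2 * gromov x⁻¹ y ≤ norm x ∧ 2 * gromov x⁻¹ y ≤ norm y)
    (h2 : ∀ x ∈ V, ∀ y ∈ V, ∀ z ∈ V, x * y ≠ 1 → y * z ≠ 1 →
      gromov x⁻¹ y + gromov y⁻¹ z < norm y) (l : List (FreeGroup α)) :
    ∀ y, (∀ x ∈ y :: l, x ∈ V) → (y :: l).IsChain (fun a b => a * b ≠ 1) →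
      (y :: l).length ≤ norm (y :: l).prod ∧ ∀ x ∈ V, x * y ≠ 1 →
        gromov x⁻¹ (y :: l).prod = gromov x⁻¹ y ∧
          gromov x⁻¹ y + (y :: l).length ≤ norm (y :: l).prod := by
  induction l with
  | nil =>
    intro y hy _
    have hy := hy y (by simp)
    have := Nat.pos_of_ne_zero (fun h => h0 y hy (norm_eq_zero.1 h))
    simp only [List.prod_cons, List.prod_nil, mul_one, List.length_cons, List.length_nil]
    refine ⟨by omega, fun x hx hxy => ⟨trivial, ?_⟩⟩
    have := (h1 x hx y hy hxy).2
    omega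
  | cons z l ih =>
    intro y hy hc
    have hyV := hy y (by simp)
    have hzV := hy z (by simp)
    rw [List.isChain_cons_cons] at hc
    obtain ⟨e1, e2⟩ := (ih z (fun x hx => hy x (List.mem_cons_of_mem _ hx)) hc.2).2 y hyV hc.1
    have e3 := norm_mul_add y (z :: l).prod
    have e4 := norm_inv_mul (y * (z :: l).prod) y
    rw [mul_inv_rev, mul_assoc, inv_mul_cancel, mul_one, norm_inv_eq] at e4
    rw [List.prod_cons, List.length_cons]
    rw [e1] at e3
    have := Nat.pos_of_ne_zero (fun h => h0 y hyV (norm_eq_zero.1 h))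
    have e5 := h1 y hyV z hzV hc.1
    refine ⟨by omega, fun x hx hxy => ?_⟩
    have e6 := h2 x hx y hyV z hzV hxy hc.1
    -- By `e1`, `e3` and `e4` the product and `y` share a prefix of length `norm y - gromov y⁻¹ z`,
    -- which exceeds `gromov x⁻¹ y` by `e6`. The ultrametric inequality in both directions then
    -- forces `x⁻¹` to meet the product exactly as it meets `y`.
    have e7 := min_gromov_le x⁻¹ y (y * (z :: l).prod)
    have e8 := min_gromov_le x⁻¹ (y * (z :: l).prod) y
    rw [gromov_comm y] at e7
    omega

theorem length_le_norm_prod {V : Set (FreeGroup α)} (h0 : ∀ x ∈ V, x ≠ 1)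
    (h1 : ∀ x ∈ V, ∀ y ∈ V, x * y ≠ 1 → 2 * gromov x⁻¹ y ≤ norm x ∧ 2 * gromov x⁻¹ y ≤ norm y)
    (h2 : ∀ x ∈ V, ∀ y ∈ V, ∀ z ∈ V, x * y ≠ 1 → y * z ≠ 1 →
      gromov x⁻¹ y + gromov y⁻¹ z < norm y) {l : List (FreeGroup α)}
    (hl : ∀ x ∈ l, x ∈ V) (hc : l.IsChain (fun a b => a * b ≠ 1)) : l.length ≤ norm l.prod := by
  cases l with
  | nil => simp
  | cons y l => exact (length_le_norm_prod_aux h0 h1 h2 l y hl hc).1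

theorem mem_of_mem_toWord {I : Set α} {w : FreeGroup α}
    (hw : w ∈ Subgroup.closure (of '' I)) : ∀ a ∈ w.toWord, a.1 ∈ I := by
  induction hw using Subgroup.closure_induction with
  | mem w h =>
    obtain ⟨z, hz, rfl⟩ := h
    simpa using hz
  | one => simp
  | mul a b _ _ ha hb =>
    intro c hc
    rcases List.mem_append.1 ((toWord_mul_sublist a b).subset hc) with h | h
    exacts [ha c h, hb c h]
  | inv a _ ha =>
    intro c hc
    rw [toWord_inv, invRev, List.mem_reverse, List.mem_map] at hc
    obtain ⟨d, hd, rfl⟩ := hc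
    exact ha d hd

theorem exists_finset_mem_closure (w : FreeGroup α) :
    ∃ I : Finset α, w ∈ Subgroup.closure (of '' (I : Set α)) := by
  induction w using FreeGroup.induction_on with
  | C1 => exact ⟨∅, one_mem _⟩
  | of x => exact ⟨{x}, Subgroup.subset_closure ⟨x, by simp, rfl⟩⟩
  | inv_of x ih => exact ih.imp fun I hI => inv_mem hI
  | mul a b ha hb =>
    obtain ⟨I, hI⟩ := ha
    obtain ⟨J, hJ⟩ := hb
    refine ⟨I ∪ J, mul_mem (Subgroup.closure_mono (Set.image_mono ?_) hI)
      (Subgroup.closure_mono (Set.image_mono ?_) hJ)⟩ <;> simp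

end FreeGroup

/-! ### Moves with prescribed sources and targets, and their action on letters. -/

namespace BigFree

open FreeGroup

variable {X : Type u}

/-- The subgroup of `Aut(F(X))` generated by all `E_{xy}` with `x ∈ J^±` and `y ∈ I^±`. -/
def nielsenSubgroup (J I : Set X) : Subgroup (RAut X) :=
  Subgroup.closure (Elem.toAut '' {E | E.src.1 ∈ J ∧ E.tgt.1 ∈ I})

theorem Elem.toAut_mem {J I : Set X} (E : Elem X) (h1 : E.src.1 ∈ J) (h2 : E.tgt.1 ∈ I) :
    E.toAut ∈ nielsenSubgroup J I :=
  Subgroup.subset_closure ⟨E, ⟨h1, h2⟩, rfl⟩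

theorem nielsenSubgroup_mono {J J' I I' : Set X} (hJ : J ⊆ J') (hI : I ⊆ I') :
    nielsenSubgroup J I ≤ nielsenSubgroup J' I' :=
  Subgroup.closure_mono (Set.image_mono fun _ h => ⟨hJ h.1, hI h.2⟩)

theorem act_of_mem_nielsenSubgroup {J I : Set X} {γ : RAut X} (hγ : γ ∈ nielsenSubgroup J I)
    {x : X} (hx : x ∉ J) : act (of x) γ = of x := by
  induction hγ using Subgroup.closure_induction with
  | mem g h =>
    obtain ⟨E, hE, rfl⟩ := h
    exact E.act_of_ne x fun h => hx (h ▸ hE.1)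
  | one => rfl
  | mul a b _ _ ha hb => rw [act_mul, ha, hb]
  | inv a _ ha =>
    conv_lhs => rw [← ha]
    rw [← act_mul, mul_inv_cancel, act_one]

theorem act_eq_one {w : FreeGroup X} {α : RAut X} : act w α = 1 ↔ w = 1 :=
  map_eq_one_iff α.unop α.unop.injective

theorem act_toFree_bar (a : Letter X) (α : RAut X) :
    act a.bar.toFree α = (act a.toFree α)⁻¹ := by
  rw [Letter.toFree_bar, inv_act]

theorem toFree_injective : Function.Injective (Letter.toFree (X := X)) := by
  classical
  intro a b h
  have := congrArg toWord h
  simpa [Letter.toFree, toWord_mk] using this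

theorem toFree_ne_one (a : Letter X) : a.toFree ≠ 1 := by
  classical
  intro h
  have := congrArg toWord h
  simp [Letter.toFree, toWord_mk] at this

theorem act_mk (l : List (Letter X)) (α : RAut X) :
    act (mk l) α = (l.map fun a => act a.toFree α).prod := by
  induction l with
  | nil => exact map_one α.unop
  | cons a l ih =>
    have : mk (a :: l) = a.toFree * mk l := by simp [Letter.toFree, mul_mk]
    rw [this, mul_act, ih, List.map_cons, List.prod_cons]

theorem act_toFree_of_fixed {α : RAut X} {a : Letter X} (h : act (of a.1) α = of a.1) :
    act a.toFree α = a.toFree := by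
  rcases a with ⟨x, _ | _⟩
  · exact (inv_act _ _).trans (congrArg _ h)
  · exact h

theorem norm_act_toFree [DecidableEq X] (a : Letter X) (α : RAut X) :
    norm (act a.toFree α) = norm (act (of a.1) α) := by
  rcases a with ⟨x, _ | _⟩
  · change norm (act (of x)⁻¹ α) = _
    rw [inv_act, norm_inv_eq]
  · rfl

theorem Elem.act_toAut_mul (E : Elem X) (α : RAut X) :
    act E.src.toFree (E.toAut * α) = act E.src.toFree α * act E.tgt.toFree α := by
  rw [act_mul, E.act_src, mul_act]

theorem Elem.act_toAut_mul_of_ne (E : Elem X) (α : RAut X) {a : Letter X} (h : a.1 ≠ E.src.1) :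
    act a.toFree (E.toAut * α) = act a.toFree α := by
  rw [act_mul]
  exact congrArg (fun w => act w α) (E.hom_toFree_of_ne a h)

/-- The elementary automorphism `E_{ab}` for letters over different generators. -/
def Elem.ofNe (a b : Letter X) (h : a.1 ≠ b.1) : Elem X :=
  ⟨a, b, fun e => h (e ▸ rfl), fun e => h (e ▸ rfl)⟩

/-! ### Nielsen reduction when only the generators in `J` may be changed. -/

/-- The left halves of the images of the letters over `I`. -/
def halves [DecidableEq X] (I : Finset X) (α : RAut X) (a : {a : Letter X // a.1 ∈ I}) :
    List (Letter X) :=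
  leftHalf (act a.1.toFree α)

/-- The measure that is minimized in the Nielsen reduction of the images of `I`. -/
def nielsenMeasure [DecidableEq X] (I : Finset X) (α : RAut X) :
    ℕ × ({a : Letter X // a.1 ∈ I} → List (Letter X)) :=
  (∑ x ∈ I, norm (act (of x) α), halves I α)

/-- The well-founded relation on the values of `nielsenMeasure`. -/
def measureLT (I : Finset X) (m n : ℕ × ({a : Letter X // a.1 ∈ I} → List (Letter X))) : Prop :=
  Prod.Lex (· < ·) (Pi.Lex WellOrderingRel fun {_} => List.Shortlex WellOrderingRel) m n

instance finite_letters (I : Finset X) : Finite {a : Letter X // a.1 ∈ I} :=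
  Finite.of_injective (β := I × Bool) (fun a => (⟨a.1.1, a.2⟩, a.1.2)) fun a b h => by
    simp only [Prod.mk.injEq, Subtype.mk.injEq] at h
    exact Subtype.ext (Prod.ext h.1 h.2)

/-- The alphabet may be infinite, but shortlex over a well-order is well-founded, and only finitely
many letters over `I` are compared. -/
theorem wellFounded_measureLT (I : Finset X) : WellFounded (measureLT I) :=
  WellFounded.prod_lex Nat.lt_wfRel.wf
    (Pi.Lex.wellFounded _ fun _ => List.Shortlex.wf WellOrderingRel.isWellOrder.wf)

section Reduction

variable [DecidableEq X] {I : Finset X} {J : Set X} {α : RAut X}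

theorem norm_le_of_not_measureLT (E : Elem X) (hE : E.src.1 ∈ I)
    (h : ¬ measureLT I (nielsenMeasure I (E.toAut * α)) (nielsenMeasure I α)) :
    norm (act E.src.toFree α) ≤ norm (act E.src.toFree α * act E.tgt.toFree α) := by
  by_contra! hlt
  refine h (Prod.Lex.left _ _ (Finset.sum_lt_sum ?_ ⟨E.src.1, hE, ?_⟩))
  · intro x hx
    by_cases hxE : x = E.src.1
    · rw [hxE, ← norm_act_toFree, ← norm_act_toFree, E.act_toAut_mul]
      exact hlt.le
    · exact (congrArg FreeGroup.norm (E.act_toAut_mul_of_ne α (a := (x, true)) hxE)).le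
  · rwa [← norm_act_toFree, ← norm_act_toFree, E.act_toAut_mul]

/-- Under `hn` and `hl` the move leaves the total length and all left halves unchanged except the
one of `E.src.bar`, so a smaller value there would lower the measure, wherever that index stands in
the well-order. -/
theorem not_shortlex_of_not_measureLT (E : Elem X) (hE : E.src.1 ∈ I)
    (h : ¬ measureLT I (nielsenMeasure I (E.toAut * α)) (nielsenMeasure I α))
    (hn : norm (act E.src.toFree α * act E.tgt.toFree α) = norm (act E.src.toFree α))
    (hl : leftHalf (act E.src.toFree α * act E.tgt.toFree α) = leftHalf (act E.src.toFree α)) :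
    ¬ List.Shortlex WellOrderingRel (leftHalf (act E.src.toFree α * act E.tgt.toFree α)⁻¹)
      (leftHalf (act E.src.toFree α)⁻¹) := by
  intro hs
  apply h
  have hsum : (nielsenMeasure I (E.toAut * α)).1 = (nielsenMeasure I α).1 := by
    refine Finset.sum_congr rfl fun x hx => ?_
    by_cases hxE : x = E.src.1
    · rw [hxE, ← norm_act_toFree, ← norm_act_toFree, E.act_toAut_mul, hn]
    · exact congrArg FreeGroup.norm (E.act_toAut_mul_of_ne α (a := (x, true)) hxE)
  have hother : ∀ a : {a : Letter X // a.1 ∈ I}, a.1 ≠ E.src.bar →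
      halves I (E.toAut * α) a = halves I α a := by
    intro a ha
    by_cases haE : a.1.1 = E.src.1
    · rcases (Letter.eq_or_eq_bar_iff _ _).2 haE with e | e
      · simp only [halves, e, E.act_toAut_mul, hl]
      · exact absurd e ha
    · exact congrArg leftHalf (E.act_toAut_mul_of_ne α haE)
  rw [measureLT, Prod.lex_def]
  refine Or.inr ⟨hsum, ⟨⟨E.src.bar, hE⟩, fun a ha => hother a fun e => ?_, ?_⟩⟩
  · have : a = ⟨E.src.bar, hE⟩ := Subtype.ext e
    rw [this] at ha
    exact irrefl_of WellOrderingRel _ ha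
  · change List.Shortlex _ (leftHalf _) (leftHalf _)
    rwa [act_toFree_bar, act_toFree_bar, E.act_toAut_mul]

theorem norm_act_of_fixed {a : Letter X} (h : act (of a.1) α = of a.1) :
    norm (act a.toFree α) = 1 := by
  rw [norm_act_toFree, h, norm_of]

theorem gromov_toFree {a b : Letter X} (h : a ≠ b) : gromov a.toFree b.toFree = 0 := by
  simp [gromov, Letter.toFree, toWord_mk, lcpLength, h]

/-- `α` has minimal measure among its images under the moves `E_{xy}`, `x ∈ J^±`, `y ∈ I^±`, and
fixes the generators in `I \ J`. -/
structure IsNielsenMinimal (J : Set X) (I : Finset X) (α : RAut X) : Prop where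
  subset : J ⊆ I
  fix : ∀ x ∈ I, x ∉ J → act (of x) α = of x
  min : ∀ E : Elem X, E.src.1 ∈ J → E.tgt.1 ∈ I →
    ¬ measureLT I (nielsenMeasure I (E.toAut * α)) (nielsenMeasure I α)

namespace IsNielsenMinimal

theorem two_mul_gromov_le_right (h : IsNielsenMinimal J I α) {a b : Letter X} (ha : a.1 ∈ J)
    (hb : b.1 ∈ I) (hab : a.1 ≠ b.1) :
    2 * gromov (act a.toFree α)⁻¹ (act b.toFree α) ≤ norm (act b.toFree α) := by
  have h1 := norm_le_of_not_measureLT (Elem.ofNe a b hab) (h.subset ha) (h.min _ ha hb)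
  have h2 := norm_mul_add (act a.toFree α) (act b.toFree α)
  simp only [Elem.ofNe] at h1
  omega

theorem two_mul_gromov_le_left (h : IsNielsenMinimal J I α) {a b : Letter X} (ha : a.1 ∈ I)
    (hb : b.1 ∈ J) (hab : a.1 ≠ b.1) :
    2 * gromov (act a.toFree α)⁻¹ (act b.toFree α) ≤ norm (act a.toFree α) := by
  have := h.two_mul_gromov_le_right (a := b.bar) (b := a.bar) hb ha hab.symm
  rwa [act_toFree_bar, act_toFree_bar, inv_inv, gromov_comm, norm_inv_eq] at this

/-- Moves with source outside of `J` are not available. They are not needed: such a letter is fixed,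
so its image has length 1, and half of a length 1 leaves no room for cancellation. -/
theorem two_mul_gromov_le (h : IsNielsenMinimal J I α) {a b : Letter X} (ha : a.1 ∈ I)
    (hb : b.1 ∈ I) (hab : b ≠ a.bar) :
    2 * gromov (act a.toFree α)⁻¹ (act b.toFree α) ≤ norm (act a.toFree α) ∧
      2 * gromov (act a.toFree α)⁻¹ (act b.toFree α) ≤ norm (act b.toFree α) := by
  by_cases hne : a.1 = b.1
  · obtain rfl : b = a := ((Letter.eq_or_eq_bar_iff b a).2 hne.symm).resolve_right hab
    have := two_mul_gromov_inv_self_lt (mt act_eq_one.1 (toFree_ne_one b) : act b.toFree α ≠ 1)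
    omega
  by_cases haJ : a.1 ∈ J <;> by_cases hbJ : b.1 ∈ J
  · exact ⟨h.two_mul_gromov_le_left ha hbJ hne, h.two_mul_gromov_le_right haJ hb hne⟩
  · have h1 := norm_act_of_fixed (h.fix _ hb hbJ)
    have h2 := h.two_mul_gromov_le_right haJ hb hne
    omega
  · have h1 := norm_act_of_fixed (h.fix _ ha haJ)
    have h2 := h.two_mul_gromov_le_left ha hbJ hne
    omega
  · rw [← act_toFree_bar, act_toFree_of_fixed (a := a.bar) (h.fix _ ha haJ),
      act_toFree_of_fixed (h.fix _ hb hbJ), gromov_toFree hab.symm]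
    simp

/-- If the second half of `b` is cancelled by `a`, then the tie-breaking order does not allow to
replace it by the inverse of the first half. -/
theorem not_shortlex (h : IsNielsenMinimal J I α) {a b : Letter X} {n : ℕ} (ha : a.1 ∈ J)
    (hb : b.1 ∈ I) (hab : a.1 ≠ b.1) (hn : gromov (act a.toFree α)⁻¹ (act b.toFree α) = n)
    (hbn : norm (act b.toFree α) = 2 * n) (han : 2 * n ≤ norm (act a.toFree α)) :
    ¬ List.Shortlex WellOrderingRel ((act b.toFree α)⁻¹.toWord.take n)
      ((act b.toFree α).toWord.take n) := by
  intro hs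
  obtain ⟨h1, h2⟩ := toWord_inv_mul_of_half hn hbn
  have h3 := norm_mul_add (act a.toFree α) (act b.toFree α)
  have hl : (act b.toFree α).toWord.length = 2 * n := hbn
  have hl2 : (act a.toFree α)⁻¹.toWord.length = norm (act a.toFree α) := norm_inv_eq
  obtain ⟨h4, h5⟩ := leftHalf_replace h1 h2 (by simp [hl])
    (by simp only [List.length_take, List.length_drop]; omega)
  -- Write the image of `b` as `p q⁻¹` with halves of length `n`. The image of `a` ends in `p⁻¹`,
  -- and the move `E_{ab}` turns this ending into `q⁻¹`, so only the left half of the inverse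
  -- changes, with `p` replaced by `q`.
  rw [mul_inv_rev, inv_inv, inv_inv] at h4
  have h6 := h5 _ hs
  rw [← mul_inv_rev] at h6
  exact not_shortlex_of_not_measureLT (Elem.ofNe a b hab) (h.subset ha) (h.min _ ha hb)
    (by simp only [Elem.ofNe]; omega) h4 h6

/-- If the image of `b` were entirely eaten up, both neighbours would cancel exactly half of it.
Writing it as `p q⁻¹`, the tie-breaking order forbids `q < p` because of `a`, and `p < q` because of
`c`; so `p = q` and the image would be trivial. -/
theorem gromov_add_gromov_lt (h : IsNielsenMinimal J I α) {a b c : Letter X} (ha : a.1 ∈ I)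
    (hb : b.1 ∈ I) (hc : c.1 ∈ I) (hab : b ≠ a.bar) (hbc : c ≠ b.bar) :
    gromov (act a.toFree α)⁻¹ (act b.toFree α) + gromov (act b.toFree α)⁻¹ (act c.toFree α) <
      norm (act b.toFree α) := by
  by_contra! hle
  obtain ⟨h1, h2⟩ := h.two_mul_gromov_le ha hb hab
  obtain ⟨h3, h4⟩ := h.two_mul_gromov_le hb hc hbc
  have hb1 : act b.toFree α ≠ 1 := mt act_eq_one.1 (toFree_ne_one b)
  have hb0 := Nat.pos_of_ne_zero fun h => hb1 (norm_eq_zero.1 h)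
  obtain ⟨n, hn⟩ : ∃ n, gromov (act a.toFree α)⁻¹ (act b.toFree α) = n := ⟨_, rfl⟩
  have hn' : gromov (act b.toFree α)⁻¹ (act c.toFree α) = n := by omega
  have hbn : norm (act b.toFree α) = 2 * n := by omega
  -- Here `n > 0`, and letters outside of `J` have images of length 1, too short to cancel half of
  -- `b` under the bounds above. Hence `a` and `c` are legitimate sources of moves.
  have memJ : ∀ d : Letter X, d.1 ∈ I → 2 * n ≤ norm (act d.toFree α) → d.1 ∈ J := by
    intro d hd hdn
    by_contra hdJ
    have := norm_act_of_fixed (h.fix _ hd hdJ)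
    omega
  have self : ∀ d : Letter X, 2 * gromov (act d.toFree α)⁻¹ (act d.toFree α) ≠
      norm (act d.toFree α) := fun d =>
    (two_mul_gromov_inv_self_lt (mt act_eq_one.1 (toFree_ne_one d))).ne
  have hab' : a.1 ≠ b.1 := by
    intro e
    obtain rfl := ((Letter.eq_or_eq_bar_iff b a).2 e.symm).resolve_right hab
    exact self b (by omega)
  have hbc' : c.1 ≠ b.1 := by
    intro e
    obtain rfl := ((Letter.eq_or_eq_bar_iff c b).2 e).resolve_right hbc
    exact self c (by omega)
  have s1 := h.not_shortlex (memJ a ha (by omega)) hb hab' hn hbn (by omega)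
  have s2 := h.not_shortlex (a := c.bar) (b := b.bar) (n := n) (memJ c hc (by omega)) hb hbc'
    (by rw [act_toFree_bar, act_toFree_bar, inv_inv, gromov_comm, hn'])
    (by rw [act_toFree_bar, norm_inv_eq, hbn])
    (by rw [act_toFree_bar, norm_inv_eq]; omega)
  rw [act_toFree_bar, inv_inv] at s2
  have heq := Std.Trichotomous.trichotomous _ _ s1 s2
  have h5 := eq_mk_take_mul_inv (act b.toFree α) n
  rw [hbn, show 2 * n - n = n by omega, heq, mul_inv_cancel] at h5
  exact hb1 h5

/-- A generator in the subgroup generated by a Nielsen reduced set is a member of the set. -/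
theorem exists_letter (h : IsNielsenMinimal J I α) {z : X} (hz : z ∈ J) {w : FreeGroup X}
    (hw : w ∈ Subgroup.closure (of '' (I : Set X))) (hwz : act w α = of z) :
    ∃ a : Letter X, a.1 ∈ J ∧ act a.toFree α = of z := by
  have hI := mem_of_mem_toWord hw
  have hr := isReduced_toWord (x := w)
  obtain ⟨l, hl⟩ : ∃ l, w.toWord = l := ⟨_, rfl⟩
  rw [← mk_toWord (x := w), act_mk] at hwz
  rw [hl] at hI hr hwz
  have hne : ∀ a b : Letter X, act a.toFree α * act b.toFree α ≠ 1 ↔ b ≠ a.bar := by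
    intro a b
    rw [← mul_act, Ne, act_eq_one, mul_eq_one_iff_inv_eq, ← Letter.toFree_bar,
      toFree_injective.eq_iff, eq_comm]
  have hlen := length_le_norm_prod
    (V := {g | ∃ a : Letter X, a.1 ∈ I ∧ act a.toFree α = g}) (l := l.map fun a : Letter X => act a.toFree α)
    (by
      rintro _ ⟨a, -, rfl⟩
      exact mt act_eq_one.1 (toFree_ne_one a))
    (by
      rintro _ ⟨a, ha, rfl⟩ _ ⟨b, hb, rfl⟩ hab
      exact h.two_mul_gromov_le ha hb ((hne a b).1 hab))
    (by
      rintro _ ⟨a, ha, rfl⟩ _ ⟨b, hb, rfl⟩ _ ⟨c, hc, rfl⟩ hab hbc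
      exact h.gromov_add_gromov_lt ha hb hc ((hne a b).1 hab) ((hne b c).1 hbc))
    (by
      intro g hg
      obtain ⟨a, ha, rfl⟩ := List.mem_map.1 hg
      exact ⟨a, hI a ha, rfl⟩)
    (by
      rw [List.isChain_map]
      refine hr.imp fun a b hab => (hne a b).2 ?_
      rintro rfl
      have := hab rfl
      simp [Letter.bar] at this)
  rw [hwz, norm_of, List.length_map] at hlen
  match l, hlen, hwz, hI with
  | [], _, hwz, _ => exact absurd hwz (one_ne_of z)
  | [a], _, hwz, hI =>
    have ha : act (Letter.toFree a) α = of z := by simpa using hwz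
    refine ⟨a, ?_, ha⟩
    -- A letter over `I \ J` is its own image, hence would equal `z`, which lies in `J`.
    by_contra haJ
    rw [act_toFree_of_fixed (h.fix _ (hI a (by simp)) haJ)] at ha
    have : a = (z, true) := toFree_injective ha
    exact haJ (this ▸ hz)
  | _ :: _ :: _, hlen, _, _ => simp at hlen

end IsNielsenMinimal

/-- The minimum is taken over the whole coset of `α`, so one more move cannot lower it; the moves do
not touch the generators outside of `J`. -/
theorem exists_isNielsenMinimal (hJI : J ⊆ I)
    (hfix : ∀ x ∈ I, x ∉ J → act (of x) α = of x) :
    ∃ γ ∈ nielsenSubgroup J I, IsNielsenMinimal J I (γ * α) := by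
  obtain ⟨_, ⟨γ, hγ, rfl⟩, hmin⟩ := (wellFounded_measureLT I).has_min
    ((fun γ => nielsenMeasure I (γ * α)) '' (nielsenSubgroup J (I : Set X) : Set (RAut X)))
    ⟨_, 1, one_mem _, rfl⟩
  refine ⟨γ, hγ, hJI, fun x hx hxJ => ?_, fun E h1 h2 => ?_⟩
  · rw [act_mul, act_of_mem_nielsenSubgroup hγ hxJ, hfix x hx hxJ]
  · rw [← mul_assoc]
    exact hmin _ ⟨_, mul_mem (E.toAut_mem h1 h2) hγ, rfl⟩

end Reduction

/-! ### Fixing further generators by left multiplication. -/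

/-- Any letter is carried to any letter over a different generator by two elementary
automorphisms. -/
theorem exists_act_toFree_eq_of_ne {J : Set X} {a b : Letter X} (ha : a.1 ∈ J) (hb : b.1 ∈ J)
    (hab : a.1 ≠ b.1) : ∃ γ ∈ nielsenSubgroup J J, act a.toFree γ = b.toFree := by
  refine ⟨_, mul_mem ((Elem.ofNe a b hab).toAut_mem ha hb)
    ((Elem.ofNe b.bar a hab.symm).toAut_mem hb ha), ?_⟩
  have h1 := (Elem.ofNe a b hab).act_src
  have h2 := (Elem.ofNe b.bar a hab.symm).act_src
  have h3 : act a.toFree (Elem.ofNe b.bar a hab.symm).toAut = a.toFree :=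
    (Elem.ofNe b.bar a hab.symm).hom_toFree_of_ne a hab
  simp only [Elem.ofNe] at h1 h2 h3 ⊢
  rw [act_mul, h1, mul_act, h3, ← inv_inv b.toFree, inv_act, ← Letter.toFree_bar, h2]
  simp

theorem exists_act_toFree_eq {J : Set X} {a b : Letter X} (ha : a.1 ∈ J) (hb : b.1 ∈ J)
    (hJ : J.Nontrivial) : ∃ γ ∈ nielsenSubgroup J J, act a.toFree γ = b.toFree := by
  by_cases hab : a.1 = b.1
  · obtain ⟨t, ht, hta⟩ := hJ.exists_ne a.1
    obtain ⟨γ, hγ, h1⟩ := exists_act_toFree_eq_of_ne (a := a) (b := (t, true)) ha ht hta.symm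
    obtain ⟨δ, hδ, h2⟩ := exists_act_toFree_eq_of_ne (a := (t, true)) (b := b) ht hb
      (fun e => hta (e.trans hab.symm))
    exact ⟨γ * δ, mul_mem hγ hδ, by rw [act_mul, h1, h2]⟩
  · exact exists_act_toFree_eq_of_ne ha hb hab

/-- If `α` fixes the generators in `I \ J` and the image of `I` generates a subgroup that contains
the generator `z ∈ J`, then left multiplication by moves with source in `J` makes `α` fix `z`. -/
theorem exists_mul_fixes {I : Finset X} {J : Set X} {α : RAut X} (hJI : J ⊆ I)
    (hfix : ∀ x ∈ I, x ∉ J → act (of x) α = of x) (hJ : J.Nontrivial) {z : X} (hz : z ∈ J)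
    (hzI : act (of z) α⁻¹ ∈ Subgroup.closure (of '' (I : Set X))) :
    ∃ γ ∈ nielsenSubgroup J I, act (of z) (γ * α) = of z := by
  classical
  obtain ⟨γ, hγ, hmin⟩ := exists_isNielsenMinimal hJI hfix
  -- Moves with targets in `I` preserve the subgroup generated by `I`, so the preimage of `z` stays
  -- in it when `α` is replaced by `γ * α`.
  have hγI : ∀ δ ∈ nielsenSubgroup J (I : Set X), ∀ w ∈ Subgroup.closure (of '' (I : Set X)),
      act w δ ∈ Subgroup.closure (of '' (I : Set X)) := by
    intro δ hδ
    induction hδ using Subgroup.closure_induction'' with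
    | mem g hg =>
      obtain ⟨E, hE, rfl⟩ := hg
      intro w hw
      have := E.act_mem_closure hw
      rwa [Set.insert_eq_of_mem hE.2] at this
    | inv_mem g hg =>
      obtain ⟨E, hE, rfl⟩ := hg
      intro w hw
      rw [← E.toAut_inv]
      have := E⁻¹.act_mem_closure hw
      rwa [Set.insert_eq_of_mem (show E⁻¹.tgt.1 ∈ (I : Set X) from hE.2)] at this
    | one => exact fun w hw => hw
    | mul g h _ _ hg hh =>
      intro w hw
      rw [act_mul]
      exact hh _ (hg w hw)
  obtain ⟨a, ha, haz⟩ := hmin.exists_letter hz (hγI _ (inv_mem hγ) _ hzI)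
    (by rw [← act_mul, ← act_mul]; simp)
  -- The letter `a` that is sent to `z` need not be `z`, and may even be `z⁻¹`; a second generator
  -- in `J` allows `z` to be moved to it.
  obtain ⟨δ, hδ, h⟩ := exists_act_toFree_eq (a := (z, true)) hz ha hJ
  refine ⟨δ * γ, mul_mem (nielsenSubgroup_mono subset_rfl hJI hδ) hγ, ?_⟩
  rw [mul_assoc, act_mul]
  exact (congrArg (fun w => act w (γ * α)) h).trans haz

theorem exists_mul_fixes_succ {α : RAut ℕ} {k : ℕ} (hα : ∀ i < k, act (of i) α = of i) (m : ℕ) :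
    ∃ N > m, ∃ γ ∈ nielsenSubgroup (Set.Ico k N) (Set.Iio N),
      ∀ i < k + 1, act (of i) (γ * α) = of i := by
  obtain ⟨I, hI⟩ := exists_finset_mem_closure (act (of k) α⁻¹)
  obtain ⟨M, hM⟩ := I.bddAbove
  have e : ((Finset.range (max (M + 1) (max (m + 1) (k + 2))) : Finset ℕ) : Set ℕ) =
    Set.Iio (max (M + 1) (max (m + 1) (k + 2))) := Finset.coe_range _
  -- `N` exceeds every generator in the preimage of generator `k` and the given `m`; the bound `k +
  -- 2` puts two generators into `[k, N)`.
  obtain ⟨N, hN⟩ : ∃ N, max (M + 1) (max (m + 1) (k + 2)) = N := ⟨_, rfl⟩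
  rw [hN] at e
  obtain ⟨γ, hγ, h⟩ := exists_mul_fixes (I := Finset.range N) (J := Set.Ico k N) (α := α) (z := k)
    (fun x hx => by simpa using hx.2)
    (fun x hx hxJ => hα x (by
      simp only [Finset.mem_range, Set.mem_Ico] at hx hxJ
      omega))
    ⟨k, ⟨le_rfl, by omega⟩, k + 1, ⟨by omega, by omega⟩, by omega⟩ ⟨le_rfl, by omega⟩
    (Subgroup.closure_mono (Set.image_mono fun x hx => by
      have := hM hx
      simp only [Finset.coe_range, Set.mem_Iio]
      omega) hI)
  rw [e] at hγ
  refine ⟨N, by omega, γ, hγ, fun i hi => ?_⟩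
  rcases Nat.lt_succ_iff_lt_or_eq.1 hi with h' | rfl
  · rw [act_mul, act_of_mem_nielsenSubgroup hγ (fun h => by have := h.1; omega), hα i h']
  · exact h

/-- Left multiplication by moves with source outside of `{0, ..., k - 1}` extends the set of fixed
generators from `{0, ..., k - 1}` to `{0, ..., n - 1}`. -/
theorem exists_mul_fixes_lt {α : RAut ℕ} {k n : ℕ} (hkn : k ≤ n)
    (hα : ∀ i < k, act (of i) α = of i) :
    ∃ N > n, ∃ γ ∈ nielsenSubgroup (Set.Ico k N) (Set.Iio N),
      ∀ i < n, act (of i) (γ * α) = of i := by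
  induction n, hkn using Nat.le_induction with
  | base => exact ⟨k + 1, by omega, 1, one_mem _, by simpa using hα⟩
  | succ n hn ih =>
    obtain ⟨N, hN, γ, hγ, h⟩ := ih
    obtain ⟨N', hN', γ', hγ', h'⟩ := exists_mul_fixes_succ h N
    refine ⟨N', by omega, γ' * γ, mul_mem ?_ ?_, fun i hi => ?_⟩
    · exact nielsenSubgroup_mono (Set.Ico_subset_Ico_left hn) subset_rfl hγ'
    · exact nielsenSubgroup_mono (Set.Ico_subset_Ico_right hN'.le)
        (Set.Iio_subset_Iio hN'.le) hγ
    · rw [mul_assoc, h' i hi]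

theorem exists_list_of_mem_nielsenSubgroup {X : Type*} {J I : Set X} {γ : RAut X}
    (hγ : γ ∈ nielsenSubgroup J I) :
    ∃ l : List (Elem X), (∀ E ∈ l, E.src.1 ∈ J ∧ E.tgt.1 ∈ I) ∧ (l.map Elem.toAut).prod = γ := by
  induction hγ using Subgroup.closure_induction'' with
  | mem g hg =>
    obtain ⟨E, hE, rfl⟩ := hg
    exact ⟨[E], by simpa using hE, by simp⟩
  | inv_mem g hg =>
    obtain ⟨E, hE, rfl⟩ := hg
    exact ⟨[E⁻¹], by simpa [Letter.bar] using hE, by simp [E.toAut_inv]⟩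
  | one => exact ⟨[], by simp, rfl⟩
  | mul g h _ _ hg hh =>
    obtain ⟨l, hl, rfl⟩ := hg
    obtain ⟨m, hm, rfl⟩ := hh
    exact ⟨l ++ m, fun E hE => (List.mem_append.1 hE).elim (hl E) (hm E), by simp⟩

/-! ### Infinite products of blocks as words in `𝒮`. -/

section InfiniteProduct

variable (L : ℕ → List (Elem ℕ))

/-- The positions of the infinite concatenation `... L₂ L₁ L₀`. -/
abbrev BlockPos : Type := Σₗ i : ℕᵒᵈ, Fin (L (OrderDual.ofDual i)).length

variable {L}

/-- The number of the block that contains a position. -/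
def BlockPos.block (s : BlockPos L) : ℕ := OrderDual.ofDual (ofLex s).1

/-- The letter at a position of `... L₂ L₁ L₀`. -/
def BlockPos.letter (s : BlockPos L) : Elem ℕ :=
  (L (OrderDual.ofDual (ofLex s).1))[(ofLex s).2]

/-- The position `t` in the block `i`. -/
def BlockPos.mk (i : ℕ) (t : Fin (L i).length) : BlockPos L :=
  toLex ⟨OrderDual.toDual i, t⟩

theorem BlockPos.block_antitone {s t : BlockPos L} (h : s ≤ t) : t.block ≤ s.block := by
  rcases Sigma.Lex.le_def.1 h with h | ⟨h, -⟩
  · exact le_of_lt h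
  · exact le_of_eq (congrArg OrderDual.ofDual h.symm)

theorem BlockPos.lt_of_block_lt {s t : BlockPos L} (h : t.block < s.block) : s < t :=
  Sigma.Lex.lt_def.2 (Or.inl h)

theorem BlockPos.finite_block_lt (L : ℕ → List (Elem ℕ)) (n : ℕ) :
    {s : BlockPos L | s.block < n}.Finite := by
  refine ((Set.finite_Iio n).biUnion fun i _ => Set.finite_range (BlockPos.mk (L := L) i)).subset ?_
  rintro ⟨i, t⟩ hs
  exact Set.mem_biUnion (x := OrderDual.ofDual i) hs ⟨t, rfl⟩

/-- The letters of `L i` have source in `{m i, ..., m (i + 1) - 1}` and target below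
`m (i + 1)`. -/
def IsBlocked (L : ℕ → List (Elem ℕ)) (m : ℕ → ℕ) : Prop :=
  ∀ i, ∀ E ∈ L i, E.src.1 ∈ Set.Ico (m i) (m (i + 1)) ∧ E.tgt.1 ∈ Set.Iio (m (i + 1))

variable {m : ℕ → ℕ}

theorem IsBlocked.letter (hL : IsBlocked L m) (s : BlockPos L) :
    s.letter.src.1 ∈ Set.Ico (m s.block) (m (s.block + 1)) ∧
      s.letter.tgt.1 ∈ Set.Iio (m (s.block + 1)) :=
  hL _ _ (List.getElem_mem _)

/-- A source `x` in block `i` satisfies `x ≥ m i ≥ i`, so it occurs only in the blocks up to `x`. -/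
theorem IsBlocked.finite_src (hL : IsBlocked L m) (hm : StrictMono m) (x : ℕ) :
    {s : BlockPos L | s.letter.src.1 = x}.Finite := by
  refine (BlockPos.finite_block_lt L (x + 1)).subset fun s hs => ?_
  have h1 := (hL.letter s).1.1
  have h2 := hm.id_le s.block
  simp only [Set.mem_ofPred_eq, id] at *
  omega

/-- The infinite word `... L₂ L₁ L₀`. -/
def blockWord (hL : IsBlocked L m) (hm : StrictMono m) : Word (Elem ℕ) where
  pos := BlockPos L
  letter := BlockPos.letter
  finite_fiber E := (hL.finite_src hm E.src.1).subset fun s hs => by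
    have : s.letter = E := hs
    exact congrArg (fun E => E.src.1) this

theorem not_injective_of_block_lt {φ : ℕ → BlockPos L} {n : ℕ} (h : ∀ i, (φ i).block < n) :
    ¬ Function.Injective φ := fun hφ =>
  Set.infinite_of_injective_forall_mem hφ h (BlockPos.finite_block_lt L n)

/-- To the right of a position there are only finitely many others. A chain for the inverted word
runs to the left, but its next source is the current target, which lies below the upper end of the
current block; so the block number cannot grow and the chain is confined to finitely many positions.
-/
theorem blockWord_mem (hL : IsBlocked L m) (hm : StrictMono m) :
    blockWord hL hm ∈ (nielsenWords ℕ).carrier := by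
  refine ⟨fun x => (hL.finite_src hm x.1).subset fun s hs => congrArg Prod.fst hs, ?_, ?_⟩
  · rintro ⟨φ, hφ, -⟩
    exact not_injective_of_block_lt (L := L) (φ := φ) (n := BlockPos.block (φ 0) + 1)
      (fun i => Nat.lt_succ_of_le (BlockPos.block_antitone (hφ.monotone (Nat.zero_le i))))
      hφ.injective
  · rintro ⟨φ, hφ, h⟩
    let ψ : ℕ → BlockPos L := fun i => OrderDual.ofDual (φ i)
    have hle : ∀ i, (ψ i).block ≤ (ψ 0).block := by
      intro i
      induction i with
      | zero => exact le_rfl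
      | succ i ih =>
        refine le_trans ?_ ih
        have h1 : (ψ (i + 1)).letter.src.1 = (ψ i).letter.tgt.1 := by
          have := (Letter.eq_or_eq_bar_iff _ _).1 (h i)
          exact this
        have h2 := (hL.letter (ψ (i + 1))).1.1
        have h3 := (hL.letter (ψ i)).2
        rw [h1] at h2
        exact Nat.lt_succ_iff.1 (hm.lt_iff_lt.1 (lt_of_le_of_lt h2 h3))
    exact not_injective_of_block_lt (φ := ψ) (fun i => Nat.lt_succ_of_le (hle i)) hφ.injective

/-- The finite product `L_{n-1} ... L₁ L₀`. -/
noncomputable def blockProd (g : ℕ → RAut ℕ) : ℕ → RAut ℕ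
  | 0 => 1
  | n + 1 => g n * blockProd g n

theorem finProd_blockWord (hL : IsBlocked L m) (hm : StrictMono m) (n : ℕ) :
    finProd (blockWord hL hm) (BlockPos.finite_block_lt L n).toFinset =
      blockProd (fun i => ((L i).map Elem.toAut).prod) n := by
  classical
  induction n with
  | zero =>
    have : (BlockPos.finite_block_lt L 0).toFinset = ∅ := by ext; simp
    rw [this]
    exact finProd_empty _
  | succ n ih =>
    have hsplit : (BlockPos.finite_block_lt L (n + 1)).toFinset =
        Finset.univ.image (BlockPos.mk n) ∪ (BlockPos.finite_block_lt L n).toFinset := by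
      ext s
      simp only [Set.Finite.mem_toFinset, Set.mem_ofPred_eq, Finset.mem_union, Finset.mem_image,
        Finset.mem_univ, true_and, Nat.lt_succ_iff_lt_or_eq]
      rw [or_comm]
      refine or_congr_left ⟨?_, ?_⟩
      · rcases s with ⟨i, t⟩
        rintro rfl
        exact ⟨t, rfl⟩
      · rintro ⟨t, rfl⟩
        rfl
    rw [hsplit, blockProd, ← ih]
    refine (finProd_union (blockWord hL hm) ?_).trans (congrArg (· * _) ?_)
    · intro a ha b hb
      obtain ⟨t, -, rfl⟩ := Finset.mem_image.1 ha
      have hb : BlockPos.block b < n := (Set.Finite.mem_toFinset (BlockPos.finite_block_lt L n)).1 hb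
      exact BlockPos.lt_of_block_lt hb
    · refine (congrArg (fun l => (List.map _ l).prod)
        (sort_eq_of (l := (List.finRange (L n).length).map (BlockPos.mk n)) ?_ ?_)).trans ?_
      · rw [List.pairwise_map]
        refine (List.pairwise_lt_finRange _).imp fun h => ?_
        exact Sigma.Lex.lt_def.2 (Or.inr ⟨rfl, h⟩)
      · intro a
        simp
      · refine congrArg List.prod (List.map_map.trans ?_)
        conv_rhs => rw [← List.map_getElem_finRange (L n), List.map_map]
        rfl

end InfiniteProduct

/-- The infinite product `... g₂ g₁ g₀` of automorphisms in consecutive blocks belongs to the image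
of `Ψ`. -/
theorem exists_mem_range_Psi {m : ℕ → ℕ} (hm : StrictMono m) {g : ℕ → RAut ℕ}
    (hg : ∀ i, g i ∈ nielsenSubgroup (Set.Ico (m i) (m (i + 1))) (Set.Iio (m (i + 1)))) :
    ∃ γ ∈ (Psi ℕ).range, ∀ i, ∀ x < m i, act (of x) γ = act (of x) (blockProd g i) := by
  choose L hL hLg using fun i => exists_list_of_mem_nielsenSubgroup (hg i)
  have hL : IsBlocked L m := hL
  have hgL : g = fun i => ((L i).map Elem.toAut).prod := funext fun i => (hLg i).symm
  have hf := blockWord_mem hL hm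
  refine ⟨alphaAut hf, ⟨BF.mk _ _ hf, Psi_mk hf⟩, fun i x hx => ?_⟩
  -- The later factor stands on the left and acts first; its sources are at least `m n ≥ m i > x`,
  -- so it fixes `x`.
  have stable : ∀ n, i ≤ n → act (of x) (blockProd g n) = act (of x) (blockProd g i) := by
    intro n hn
    induction n, hn using Nat.le_induction with
    | base => rfl
    | succ n hn ih =>
      rw [blockProd, act_mul, act_of_mem_nielsenSubgroup (hg n), ih]
      exact fun h => absurd (h.1.trans_lt hx) (not_lt.2 (hm.monotone hn))
  obtain ⟨A, hA⟩ := exists_act_finProd hf (of x)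
  -- Enough complete blocks are taken to contain the finite set `A` that determines the image of
  -- `x`.
  obtain ⟨M, hM⟩ := (A.image fun s => BlockPos.block (L := L) s).bddAbove
  rw [act_alphaAut, ← hA (BlockPos.finite_block_lt L (max i (M + 1))).toFinset,
    finProd_blockWord, ← hgL, stable _ (le_max_left _ _)]
  intro s hs
  have := hM (Finset.mem_coe.2 (Finset.mem_image_of_mem _ hs))
  exact (Set.Finite.mem_toFinset _).2 (lt_of_lt_of_le (Nat.lt_succ_of_le this) (le_max_right _ _))

/-! ### The back-and-forth construction and surjectivity of `Ψ`. -/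

/-- The state of the back-and-forth construction: an automorphism that fixes the generators below
a bound, together with a larger bound. -/
structure FixState where
  aut : RAut ℕ
  lower : ℕ
  upper : ℕ
  lower_lt : lower < upper
  fix : ∀ i < lower, act (of i) aut = of i

/-- The upper bound is set one stage ahead: it says how many generators must be fixed next, while
the range of the moves needed for this is known only afterwards and becomes the new upper bound. -/
theorem FixState.exists_next (s : FixState) : ∃ p : RAut ℕ × FixState,
    p.1 ∈ nielsenSubgroup (Set.Ico s.lower p.2.upper) (Set.Iio p.2.upper) ∧
      p.2.lower = s.upper ∧ p.2.aut = (p.1 * s.aut)⁻¹ := by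
  obtain ⟨N, hN, γ, hγ, h⟩ := exists_mul_fixes_lt s.lower_lt.le s.fix
  refine ⟨(γ, ⟨(γ * s.aut)⁻¹, s.upper, N, hN, fun i hi => ?_⟩), hγ, rfl, rfl⟩
  conv_lhs => rw [← h i hi]
  rw [← act_mul, mul_inv_cancel, act_one]

/-- Because of the inversion, left multiplications alternately act on the two sides of `α`. Each
block spans two steps of `n`, which is why blocks of the same parity abut without overlapping. -/
theorem exists_back_and_forth (α : RAut ℕ) : ∃ (n : ℕ → ℕ) (γ β : ℕ → RAut ℕ), StrictMono n ∧
    β 0 = α ∧ (∀ j, γ j ∈ nielsenSubgroup (Set.Ico (n j) (n (j + 2))) (Set.Iio (n (j + 2)))) ∧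
    (∀ j, β (j + 1) = (γ j * β j)⁻¹) ∧ ∀ j, ∀ i < n j, act (of i) (β j) = of i := by
  choose next hnext using FixState.exists_next
  let st : ℕ → FixState := fun j =>
    Nat.rec ⟨α, 0, 1, one_pos, fun i hi => absurd hi (Nat.not_lt_zero i)⟩ (fun _ s => (next s).2) j
  have hst : ∀ j, st (j + 1) = (next (st j)).2 := fun j => rfl
  have hlow : ∀ j, (st (j + 1)).lower = (st j).upper := fun j => (hnext (st j)).2.1
  refine ⟨fun j => (st j).lower, fun j => (next (st j)).1, fun j => (st j).aut,
    strictMono_nat_of_lt_succ fun j => ?_, rfl, fun j => ?_, fun j => (hnext (st j)).2.2,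
    fun j => (st j).fix⟩
  · rw [hlow]
    exact (st j).lower_lt
  · have := (hnext (st j)).1
    rwa [← hst, ← hlow (j + 1)] at this

theorem Psi_surjective : Function.Surjective (Psi ℕ) := by
  intro α
  obtain ⟨n, γ, β, hn, h0, hγ, hβ, hfix⟩ := exists_back_and_forth α
  obtain ⟨δ, hδ, hδ'⟩ := exists_mem_range_Psi (m := fun i => n (2 * i)) (g := fun i => γ (2 * i))
    (fun i j h => hn (by omega)) (fun i => hγ (2 * i))
  obtain ⟨ε, hε, hε'⟩ := exists_mem_range_Psi (m := fun i => n (2 * i + 1))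
    (g := fun i => γ (2 * i + 1)) (fun i j h => hn (by omega)) (fun i => hγ (2 * i + 1))
  -- Two stages give `β (2i+2) = γ (2i) * β (2i) * (γ (2i+1))⁻¹`.
  have hprod : ∀ i, blockProd (fun i => γ (2 * i)) i * α =
      β (2 * i) * blockProd (fun i => γ (2 * i + 1)) i := by
    intro i
    induction i with
    | zero => simp [blockProd, h0]
    | succ i ih =>
      rw [blockProd, mul_assoc, ih, blockProd, show 2 * (i + 1) = 2 * i + 1 + 1 by ring, hβ, hβ]
      group
  have key : δ * α = ε := by
    have hgen : ∀ x, act (of x) (δ * α) = act (of x) ε := by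
      intro x
      -- At index `i = x + 1` the generator `x` is fixed by `β (2i)`, and both infinite products
      -- agree on it with their finite parts.
      have hx : x < n (2 * (x + 1)) := lt_of_lt_of_le (show x < 2 * (x + 1) by omega) (hn.id_le _)
      rw [act_mul, hδ' (x + 1) x hx, ← act_mul, hprod, act_mul, hfix _ x hx,
        hε' (x + 1) x (hx.trans (hn (Nat.lt_succ_self _)))]
    have hom : (δ * α).unop.toMonoidHom = ε.unop.toMonoidHom := FreeGroup.ext_hom _ _ hgen
    exact RAut.ext fun w => DFunLike.congr_fun hom w
  have : α ∈ (Psi ℕ).range := by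
    rw [← eq_inv_mul_iff_mul_eq] at key
    exact key ▸ mul_mem (inv_mem hδ) hε
  exact this

theorem single_mem_nielsenWords {X : Type*} (E : Elem X) :
    Word.single E ∈ (nielsenWords X).carrier := by
  refine ⟨fun x => Set.toFinite (α := PUnit) _, ?_, ?_⟩
  · rintro ⟨φ, hφ, -⟩
    exact (hφ Nat.zero_lt_one).ne rfl
  · rintro ⟨φ, hφ, -⟩
    exact (hφ Nat.zero_lt_one).ne rfl

theorem Psi_single {X : Type*} (E : Elem X) :
    Psi X (BF.mk _ (Word.single E) (single_mem_nielsenWords E)) = E.toAut := by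
  rw [Psi_mk]
  refine RAut.ext fun w => ?_
  obtain ⟨A, hA⟩ := exists_act_finProd (single_mem_nielsenWords E) w
  have e : insert (PUnit.unit : (Word.single E).pos) A = {PUnit.unit} := by
    ext a
    exact iff_of_true (Finset.mem_insert.2 (Or.inl rfl)) (Finset.mem_singleton.2 rfl)
  rw [act_alphaAut, ← hA (insert (PUnit.unit : (Word.single E).pos) A) (Finset.subset_insert _ _), e]
  exact congrArg (act w) (finProd_singleton _ _)

end BigFree

theorem mainTheorem5 :
    Function.Surjective (BigFree.Psi ℕ) ∧
      BigFree.GeneratedInGeneralizedSense (BigFree.RAut ℕ)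
        (Set.range (BigFree.Elem.toAut (X := ℕ))) := by
  refine ⟨BigFree.Psi_surjective, BigFree.Elem ℕ, inferInstance, BigFree.nielsenWords ℕ,
    BigFree.single_mem_nielsenWords, BigFree.Psi ℕ, BigFree.Psi_surjective, ?_⟩
  simp only [BigFree.Psi_single]
  -- The set of all `E_{xy}` is already closed under inversion, so `A ∪ A⁻¹ = A`.
  refine (Set.union_eq_self_of_subset_right ?_).symm
  rintro g ⟨E, hE⟩
  exact ⟨E⁻¹, E.toAut_inv.trans (by rw [hE, inv_inv])⟩
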